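/- Let $B=\{x\in\mathbb R^2:|x|<1\}$ be the open unit disk and let $\sigma:B\to\mathbb R$ be a measurable function such that $c\le\sigma\le C$ a.e. in $B$ for some constants $0<c\le C$, and such that the (essential) support of $1-\sigma$ is a compact subset of $B$. Let $\mathcal C'_\diamond(\partial B)$ be the space of finite signed Borel measures $\mu$ on $\partial B$ with $\mu(\partial B)=0$. For those $\mu\in\mathcal C'_\diamond(\partial B)$ considered below, let $u^\mu_{\mathrm{bg}}\in W^{1,1}(B)/\mathbb R$ be the solution of $$\int_B\nabla u^\mu_{\mathrm{bg}}\cdot\nabla\varphi\,dx=\int_{\partial B}\varphi\,d\mu\qquad\text{for all }\varphi\in C^\infty(\overline B),$$ and let $u^\mu\in W^{1,1}(B)/\mathbb R$ be the solution of $$\int_B\sigma\nabla u^\mu\cdot\nabla\varphi\,dx=\int_{\partial B}\varphi\,d\mu\qquad\text{for all }\varphi\in C^\infty(\overline B)$$ that has the form $u^\mu=u^\mu_{\mathrm{bg}}+w$ with $w\in H^1(B)/\mathbb R$. Put $$Q_\sigma(\mu,\eta)=\int_B(1-\sigma)\,\nabla u^\mu\cdot\nabla u^\eta_{\mathrm{bg}}\,dx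 .$$ Let $\delta(\theta)$ be the unit point mass at $(\cos\theta,\sin\theta)\in\partial B$. Then the function $$\tilde\omega(\theta_1,\theta_2,\theta_3,\theta_4)=Q_\sigma\bigl(\delta(\theta_1)-\delta(\theta_2),\,\delta(\theta_3)-\delta(\theta_4)\bigr)$$ is well defined on $\mathbb R^4$ (the solutions $u^{\delta(\theta_1)-\delta(\theta_2)}$ and $u_{\mathrm{bg}}^{\delta(\theta_3)-\delta(\theta_4)}$ exist, the integrand is integrable, and the integral does not depend on the choice of these solutions) and is jointly real-analytic on $\mathbb R^4$. Furthermore, there is an $l>0$ such that $\tilde\omega$ extends to a function that is complex analytic in $V^4\subset\mathbb C^4$, where $V=\{z\in\mathbb C:|\operatorname{Im}z|<l\}$. -/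

import Mathlib

open MeasureTheory
open scoped ContDiff Gradient

noncomputable section

/-- The open unit disk `B`; the plane `ℝ²` is identified with `ℂ`, with its real inner product
`⟪z, w⟫ = Re z Re w + Im z Im w` and Lebesgue measure `volume`. -/
abbrev unitDisk : Set ℂ := Metric.ball (0 : ℂ) 1

/-- The boundary `∂B` of the unit disk, as a type. -/
abbrev DiskBoundary : Type := Metric.sphere (0 : ℂ) 1

/-- Lebesgue measure on the unit disk. -/
abbrev diskMeasure : Measure ℂ := volume.restrict unitDisk

/-- Admissible conductivities in the unit disk: measurable, bounded and bounded away from zero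
almost everywhere, and equal to `1` almost everywhere outside some compact subset of the open disk
(that is, the essential support of `1 - σ` is a compact subset of the open disk). -/
structure IsFeasibleConductivity (σ : ℂ → ℝ) : Prop where
  aestronglyMeasurable : AEStronglyMeasurable σ diskMeasure
  bounds : ∃ c C : ℝ, 0 < c ∧ ∀ᵐ x ∂diskMeasure, c ≤ σ x ∧ σ x ≤ C
  homogeneous : ∃ K : Set ℂ, IsCompact K ∧ K ⊆ unitDisk ∧
    ∀ᵐ x ∂diskMeasure, x ∉ K → σ x = 1

/-- `G` is the weak gradient of `u` in the unit disk. -/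
def HasWeakGradient (u : ℂ → ℝ) (G : ℂ → ℂ) : Prop :=
  ∀ φ : ℂ → ℝ, ContDiff ℝ ∞ φ → HasCompactSupport φ → tsupport φ ⊆ unitDisk →
    ∫ x in unitDisk, u x • ∇ φ x = -∫ x in unitDisk, φ x • G x

/-- `u` belongs to `W^{1,p}` of the unit disk, with weak gradient `G`. -/
structure MemSobolev (p : ENNReal) (u : ℂ → ℝ) (G : ℂ → ℂ) : Prop where
  memLp : MemLp u p diskMeasure
  memLp_grad : MemLp G p diskMeasure
  hasWeakGradient : HasWeakGradient u G

/-- The space of finite signed Borel measures on `∂B` with total mass zero. -/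
def MeanFreeMeasure : Submodule ℝ (SignedMeasure DiskBoundary) where
  carrier := {μ | μ Set.univ = 0}
  zero_mem' := by simp
  add_mem' := by
    intro a b ha hb
    simp only [Set.mem_ofPred_eq] at ha hb ⊢
    simp [ha, hb]
  smul_mem' := by
    intro c a ha
    simp only [Set.mem_ofPred_eq] at ha ⊢
    simp [ha]

/-- `u ∈ W^{1,1}(B)`, with weak gradient `G`, solves the weak conductivity equation
`∫_B σ ∇u · ∇φ dx = ∫_{∂B} φ dμ` for all `φ ∈ C^∞` of the closed disk (restrictions to the closed
disk of smooth functions on the plane). -/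
structure IsWeakNeumannSolution (σ : ℂ → ℝ) (μ : MeanFreeMeasure) (u : ℂ → ℝ) (G : ℂ → ℂ) :
    Prop where
  memSobolev : MemSobolev 1 u G
  weak_eq : ∀ φ : ℂ → ℝ, ContDiff ℝ ∞ φ →
    ∫ x in unitDisk, σ x * inner ℝ (G x) (∇ φ x) =
      ∫ᵛ y : DiskBoundary, φ (y : ℂ) ∂•(μ : SignedMeasure DiskBoundary)

/-- `u = u_bg^μ`, with weak gradient `G`: the background problem, with conductivity `1`. -/
def IsBackgroundPotential (μ : MeanFreeMeasure) (u : ℂ → ℝ) (G : ℂ → ℂ) : Prop :=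
  IsWeakNeumannSolution (fun _ => 1) μ u G

/-- `u = u^μ`, with weak gradient `G`: the solution in `W^{1,1}(B)` of the weak conductivity
equation that has the form `u_bg^μ + w` with `w ∈ H^1(B)`. -/
def IsPotential (σ : ℂ → ℝ) (μ : MeanFreeMeasure) (u : ℂ → ℝ) (G : ℂ → ℂ) : Prop :=
  IsWeakNeumannSolution σ μ u G ∧
    ∃ (u₀ : ℂ → ℝ) (G₀ : ℂ → ℂ), IsBackgroundPotential μ u₀ G₀ ∧ MemSobolev 2 (u - u₀) (G - G₀)

/-- The gradient `∇u^μ`. -/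
def gradPotential (σ : ℂ → ℝ) (μ : MeanFreeMeasure) : ℂ → ℂ :=
  Classical.epsilon fun G => ∃ u, IsPotential σ μ u G

/-- The gradient `∇u_bg^μ`. -/
def gradBackground (μ : MeanFreeMeasure) : ℂ → ℂ :=
  Classical.epsilon fun G => ∃ u, IsBackgroundPotential μ u G

/-- The bilinear form `Q_σ(μ, η) = ∫_B (1 - σ) ∇u^μ · ∇u_bg^η dx`. -/
def relativeForm (σ : ℂ → ℝ) (μ η : MeanFreeMeasure) : ℝ :=
  ∫ x in unitDisk, (1 - σ x) * inner ℝ (gradPotential σ μ x) (gradBackground η x)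

/-- The point `(cos θ, sin θ)` of `∂B`. -/
def boundaryPoint (θ : ℝ) : DiskBoundary :=
  ⟨Complex.exp (θ * Complex.I), by simp [Complex.norm_exp_ofReal_mul_I]⟩

/-- The point current source `δ(θ) - δ(φ)`, where `δ(θ)` is the unit point mass at
`(cos θ, sin θ)`. -/
def dipole (θ φ : ℝ) : MeanFreeMeasure :=
  ⟨VectorMeasure.dirac (boundaryPoint θ) 1 - VectorMeasure.dirac (boundaryPoint φ) 1, by
    simp [MeanFreeMeasure]⟩

/-- The function `ω̃(θ₁, θ₂, θ₃, θ₄) = Q_σ(δ(θ₁) - δ(θ₂), δ(θ₃) - δ(θ₄))`. -/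
def fourElectrode (σ : ℂ → ℝ) (θ : Fin 4 → ℝ) : ℝ :=
  relativeForm σ (dipole (θ 0) (θ 1)) (dipole (θ 2) (θ 3))

/-- The product strip `V^4`, where `V = {z : |Im z| < l}`. -/
def productStrip (l : ℝ) : Set (Fin 4 → ℂ) := {z | ∀ i, |(z i).im| < l}

end

/-! Only the behaviour of the background fields on a smaller concentric disk enters the form,
because `1 - σ` vanishes near the boundary; there the fields depend analytically on the position of
the electrodes.

With ℝ² identified with ℂ, the background gradient of `δ(θ) - δ(η)` is explicit: it is `π⁻¹` times
the difference of two poles `1 / conj (x - a)`, the gradients of `log |x - a|`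
(`isBackgroundPotential_dipole`). For `a = exp (i t)` and `|x| ≤ ρ < 1` the pole equals `-∑ a^(n+1)
(conj x)^n`. As an `L²`-valued series this is trigonometric in `t` with coefficients `O(ρ^n)`, so it
continues to `|Im t| < l` as soon as `exp l * ρ < 1` (`exists_poleField_series`,
`exists_analytic_extension`).

Writing `u = u_bg + w`, the correction `w` solves `∫ σ ∇w · ∇φ = ∫ (1 - σ) ∇u_bg · ∇φ`. By
Lax-Milgram `∇w` is a bounded linear image of the cut-off of `∇u_bg` (`exists_potentialOperator`).
Hence the form is `⟪R Φ, Φ'⟫` with `R` bounded and `Φ`, `Φ'` the cut-off dipole fields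
(`exists_relativeOperator`), and analyticity passes through `R`.

Independence of the choice of solutions needs uniqueness for gradients that are merely integrable,
where no energy argument is available. It rests on `ae_eq_zero_of_isCurlFree`: for a curl-free `G`
with zero Neumann data, `conj G` annihilates every `∂̄χ` with `χ` zero on the circle, hence all
monomials in `x` and `conj x`, hence all continuous functions. The same fact shows that curl-free
`L²` fields are limits of smooth gradients, so the Lax-Milgram space contains every admissible `∇w`;
the Poincaré inequality gives the converse, that its elements have primitives. -/

/-! ### Gradients and integrability on the disk -/

lemma gradient_re (φ : ℂ → ℝ) (x : ℂ) : (∇ φ x).re = fderiv ℝ φ x 1 := by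
  rw [← inner_gradient_left, Complex.inner]; simp

lemma gradient_im (φ : ℂ → ℝ) (x : ℂ) : (∇ φ x).im = fderiv ℝ φ x Complex.I := by
  rw [← inner_gradient_left, Complex.inner]; simp

lemma gradient_eq_fderiv (φ : ℂ → ℝ) (x : ℂ) :
    ∇ φ x = fderiv ℝ φ x 1 + fderiv ℝ φ x Complex.I * Complex.I := by
  apply Complex.ext <;> simp [gradient_re, gradient_im]

lemma norm_gradient (φ : ℂ → ℝ) (x : ℂ) : ‖∇ φ x‖ = ‖fderiv ℝ φ x‖ := by
  simp [gradient]

lemma contDiff_gradient {φ : ℂ → ℝ} (hφ : ContDiff ℝ ∞ φ) : ContDiff ℝ ∞ (∇ φ) := by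
  have h : ContDiff ℝ ∞ (fderiv ℝ φ) := hφ.fderiv_right (by simp)
  exact (InnerProductSpace.toDual ℝ ℂ).symm.contDiff.comp h

lemma continuous_gradient {φ : ℂ → ℝ} (hφ : ContDiff ℝ ∞ φ) : Continuous (∇ φ) :=
  (contDiff_gradient hφ).continuous

lemma exists_norm_le_of_continuous {E : Type*} [SeminormedAddCommGroup E] {f : ℂ → E}
    (hf : Continuous f) : ∃ C, 0 ≤ C ∧ ∀ x ∈ unitDisk, ‖f x‖ ≤ C := by
  obtain ⟨C, hC⟩ := (isCompact_closedBall (0 : ℂ) 1).exists_bound_of_continuousOn hf.continuousOn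
  refine ⟨max C 0, le_max_right _ _, fun x hx => (hC x (Metric.ball_subset_closedBall hx)).trans
    (le_max_left _ _)⟩

instance isFiniteMeasure_diskMeasure : IsFiniteMeasure diskMeasure :=
  ⟨by simp⟩

lemma ae_mem_unitDisk : ∀ᵐ x ∂diskMeasure, x ∈ unitDisk :=
  ae_restrict_mem measurableSet_ball

lemma memLp_of_continuous {E : Type*} [NormedAddCommGroup E] {f : ℂ → E} (hf : Continuous f)
    [SecondCountableTopologyEither ℂ E] (p : ENNReal) : MemLp f p diskMeasure := by
  obtain ⟨C, -, hC⟩ := exists_norm_le_of_continuous hf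
  refine MemLp.of_bound hf.aestronglyMeasurable C ?_
  filter_upwards [ae_mem_unitDisk] with x hx using hC x hx

lemma integrable_inner_of_continuous {G f : ℂ → ℂ} (hG : Integrable G diskMeasure)
    (hf : Continuous f) : Integrable (fun x => inner ℝ (G x) (f x)) diskMeasure := by
  obtain ⟨C, -, hC⟩ := exists_norm_le_of_continuous hf
  refine (hG.norm.mul_const C).mono' (hG.aestronglyMeasurable.inner hf.aestronglyMeasurable) ?_
  filter_upwards [ae_mem_unitDisk] with x hx
  exact (norm_inner_le_norm _ _).trans (by gcongr; exact hC x hx)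

lemma integrable_mul_of_continuous {G f : ℂ → ℂ} (hG : Integrable G diskMeasure)
    (hf : Continuous f) : Integrable (fun x => G x * f x) diskMeasure := by
  obtain ⟨C, -, hC⟩ := exists_norm_le_of_continuous hf
  refine (hG.norm.mul_const C).mono' (hG.aestronglyMeasurable.mul hf.aestronglyMeasurable) ?_
  filter_upwards [ae_mem_unitDisk] with x hx
  rw [norm_mul]; gcongr; exact hC x hx

lemma tsupport_gradient_subset (φ : ℂ → ℝ) : tsupport (∇ φ) ⊆ tsupport φ :=
  (closure_mono (Function.support_comp_subset (g := (InnerProductSpace.toDual ℝ ℂ).symm)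
    (by simp) (fderiv ℝ φ))).trans (tsupport_fderiv_subset ℝ)

/-- A function which is `C^1` in the disk has its classical gradient as weak gradient. -/
lemma hasWeakGradient_of_contDiffOn {u : ℂ → ℝ} (hu : ContDiffOn ℝ 1 u unitDisk) :
    HasWeakGradient u (∇ u) := by
  intro φ hφ hc hs
  have huc : ∀ x ∈ unitDisk, ContDiffAt ℝ 1 u x := fun x hx =>
    (hu x hx).contDiffAt (Metric.isOpen_ball.mem_nhds hx)
  have hg0 : ∀ x, x ∉ unitDisk → ∇ φ x = 0 := fun x hx =>
    image_eq_zero_of_notMem_tsupport fun h => hx (hs (tsupport_gradient_subset φ h))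
  have h0 : ∀ x, x ∉ unitDisk → φ x = 0 := fun x hx =>
    image_eq_zero_of_notMem_tsupport fun h => hx (hs h)
  have hgc : HasCompactSupport (∇ φ) :=
    hc.mono' (subset_closure.trans (tsupport_gradient_subset φ))
  have hc1 : Continuous (fun x => u x • ∇ φ x) := by
    refine continuous_of_tsupport fun x hx => ?_
    exact (huc x (hs (tsupport_gradient_subset φ (tsupport_smul_subset_right _ _ hx)))
      ).continuousAt.smul (continuous_gradient hφ).continuousAt
  have hc2 : Continuous (fun x => φ x • ∇ u x) := by
    refine continuous_of_tsupport fun x hx => ?_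
    refine hφ.continuous.continuousAt.smul ?_
    have := (huc x (hs (tsupport_smul_subset_left _ _ hx))).fderiv_right (m := 0) (by simp)
    exact (InnerProductSpace.toDual ℝ ℂ).symm.continuous.continuousAt.comp this.continuousAt
  have hc3 : Continuous (fun x => u x * φ x) := by
    refine continuous_of_tsupport fun x hx => ?_
    exact (huc x (hs (tsupport_mul_subset_right hx))).continuousAt.mul hφ.continuous.continuousAt
  have hi1 : Integrable (fun x => u x • ∇ φ x) :=
    hc1.integrable_of_hasCompactSupport (hgc.smul_left (f := u))
  have hi2 : Integrable (fun x => φ x • ∇ u x) :=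
    hc2.integrable_of_hasCompactSupport (hc.smul_right (f' := ∇ u))
  -- Pairing with a constant vector `v` reduces the vector identity to scalar integration by parts
  -- in the direction `v`; the products are globally continuous because `φ` is supported inside the
  -- disk.
  have key : ∀ v : ℂ, ∫ x, inner ℝ v (u x • ∇ φ x) = - ∫ x, inner ℝ v (φ x • ∇ u x) := by
    intro v
    have e1 : ∀ x, inner ℝ v (u x • ∇ φ x) = u x * fderiv ℝ φ x v := fun x => by
      rw [inner_smul_right, inner_gradient_right]; simp
    have e2 : ∀ x, inner ℝ v (φ x • ∇ u x) = fderiv ℝ u x v * φ x := fun x => by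
      rw [inner_smul_right, inner_gradient_right, mul_comm]; simp
    simp only [e1, e2]
    refine integral_mul_fderiv_eq_neg_fderiv_mul_of_integrable ?_ ?_ ?_
      (fun x hx => (huc x (hs hx)).differentiableAt (by simp))
      (fun x _ => hφ.differentiable (by simp) x)
    · exact (hi2.const_inner v).congr (Filter.Eventually.of_forall e2)
    · exact (hi1.const_inner v).congr (Filter.Eventually.of_forall e1)
    · exact hc3.integrable_of_hasCompactSupport (hc.mul_left (f := u))
  rw [setIntegral_eq_integral_of_forall_compl_eq_zero (fun x hx => by simp [hg0 x hx]),
    setIntegral_eq_integral_of_forall_compl_eq_zero (fun x hx => by simp [h0 x hx])]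
  refine ext_inner_left ℝ fun v => ?_
  rw [inner_neg_right, ← integral_inner hi1, ← integral_inner hi2, key]

/-! ### The explicit field of a boundary dipole -/

open ComplexConjugate in
/-- The gradient of `x ↦ log ‖x - a‖`. -/
noncomputable def poleField (a x : ℂ) : ℂ := (conj (x - a))⁻¹

lemma hasGradientAt_log_norm {a x : ℂ} (h : x ≠ a) :
    HasGradientAt (fun x => Real.log ‖x - a‖) (poleField a x) x := by
  have h0 : x - a ≠ 0 := sub_ne_zero.2 h
  have h1 : HasFDerivAt (fun x : ℂ => ‖x - a‖ ^ 2) _ x :=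
    ((hasFDerivAt_id x).sub_const a).norm_sq
  have h2 := (h1.log (by positivity)).const_mul (1 / 2)
  have h3 : (fun x : ℂ => 1 / 2 * Real.log (‖x - a‖ ^ 2)) = fun x => Real.log ‖x - a‖ := by
    funext y; rw [Real.log_pow]; push_cast; ring
  rw [hasGradientAt_iff_hasFDerivAt]
  simp only [id] at h2
  rw [h3] at h2
  refine (h2.congr_fderiv ?_)
  have h4 : poleField a x = ((‖x - a‖ ^ 2)⁻¹ : ℝ) • (x - a) := by
    rw [poleField, Complex.inv_def, Complex.conj_conj, Complex.normSq_conj, Complex.normSq_eq_norm_sq,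
      mul_comm, Complex.real_smul]
  rw [h4]
  ext v
  rw [InnerProductSpace.toDual_apply_apply, real_inner_smul_left]
  simp [-Complex.inner, ← inner_sub_left]
  ring

lemma norm_poleField (a x : ℂ) : ‖poleField a x‖ = ‖x - a‖⁻¹ := by
  rw [poleField, norm_inv, RCLike.norm_conj]

lemma measurable_poleField (a : ℂ) : Measurable (poleField a) := by
  unfold poleField; fun_prop

lemma integrable_poleField (a : ℂ) : Integrable (poleField a) diskMeasure := by
  have h : LocallyIntegrable (fun x : ℂ => x⁻¹) := by
    -- The singularity has order 1, below the real dimension 2.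
    refine locallyIntegrable_of_norm_le_rpow (C := 1) (α := 1) (by simp) (by simp) ?_
      measurable_inv.aestronglyMeasurable
    refine Filter.Eventually.of_forall fun x => ?_
    rw [norm_inv, one_mul, Real.rpow_neg_one]
  have h2 : IntegrableOn (fun x : ℂ => x⁻¹) (Metric.ball (-a) 1) :=
    (h.integrableOn_isCompact (isCompact_closedBall (-a) 1)).mono_set Metric.ball_subset_closedBall
  have h3 : IntegrableOn (fun x : ℂ => (x - a)⁻¹) unitDisk := by
    have := (measurePreserving_sub_right (volume : Measure ℂ) a).integrableOn_comp_preimage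
      (MeasurableEquiv.subRight a).measurableEmbedding (f := fun x : ℂ => x⁻¹)
      (s := Metric.ball (-a) 1)
    have hp : (fun x => x - a) ⁻¹' Metric.ball (-a) 1 = unitDisk := by
      ext x; simp [dist_eq_norm]
    rw [hp] at this
    exact this.2 h2
  refine (h3.norm).mono' (measurable_poleField a).aestronglyMeasurable ?_
  refine Filter.Eventually.of_forall fun x => ?_
  rw [norm_poleField, norm_inv]

/-- The inequality `log s ≤ s - 1`, used for `s` and for `s⁻¹`, bounds `|log s|` by `s⁻¹ + s`, and
`s⁻¹` is the norm of the pole field. -/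
lemma integrable_log_norm_sub (a : ℂ) : Integrable (fun x => Real.log ‖x - a‖) diskMeasure := by
  have h1 := (integrable_poleField a).norm
  have h2 : Integrable (fun x : ℂ => ‖x - a‖) diskMeasure :=
    memLp_one_iff_integrable.1 (memLp_of_continuous (by fun_prop) 1)
  refine (h1.add h2).mono'
    (Real.measurable_log.comp (by fun_prop)).aestronglyMeasurable (Filter.Eventually.of_forall fun x => ?_)
  rw [Pi.add_apply, norm_poleField, Real.norm_eq_abs]
  rcases eq_or_ne ‖x - a‖ 0 with h | h
  · simp [h]
  have hp : 0 < ‖x - a‖ := lt_of_le_of_ne (norm_nonneg _) h.symm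
  have l1 := Real.log_le_sub_one_of_pos hp
  have l2 := Real.log_le_sub_one_of_pos (inv_pos.2 hp)
  rw [Real.log_inv] at l2
  have := inv_pos.2 hp
  rw [abs_le]; constructor <;> linarith

/-- The field generated by a unit source at `a` and a unit sink at `b`. -/
noncomputable def dipoleField (a b x : ℂ) : ℂ := (Real.pi⁻¹ : ℝ) • (poleField b x - poleField a x)

/-- The potential of the field `dipoleField a b`. -/
noncomputable def dipolePotential (a b x : ℂ) : ℝ :=
  Real.pi⁻¹ * (Real.log ‖x - b‖ - Real.log ‖x - a‖)

lemma integrable_dipoleField (a b : ℂ) : Integrable (dipoleField a b) diskMeasure :=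
  ((integrable_poleField b).sub (integrable_poleField a)).smul (Real.pi⁻¹ : ℝ)

lemma ne_of_mem_unitDisk {a x : ℂ} (ha : ‖a‖ = 1) (hx : x ∈ unitDisk) : x ≠ a := by
  rintro rfl; simp [ha] at hx

lemma hasGradientAt_dipolePotential {a b x : ℂ} (ha : ‖a‖ = 1) (hb : ‖b‖ = 1)
    (hx : x ∈ unitDisk) : HasGradientAt (dipolePotential a b) (dipoleField a b x) x := by
  have h1 := (hasGradientAt_log_norm (ne_of_mem_unitDisk ha hx)).hasFDerivAt
  have h2 := (hasGradientAt_log_norm (ne_of_mem_unitDisk hb hx)).hasFDerivAt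
  rw [hasGradientAt_iff_hasFDerivAt, dipoleField, map_smul, map_sub]
  exact (h2.sub h1).const_mul _

lemma memSobolev_dipole {a b : ℂ} (ha : ‖a‖ = 1) (hb : ‖b‖ = 1) :
    MemSobolev 1 (dipolePotential a b) (dipoleField a b) where
  memLp := memLp_one_iff_integrable.2
    (((integrable_log_norm_sub b).sub (integrable_log_norm_sub a)).const_mul _)
  memLp_grad := memLp_one_iff_integrable.2 (integrable_dipoleField a b)
  hasWeakGradient := by
    have hlog : ∀ a : ℂ, ‖a‖ = 1 → ContDiffOn ℝ 1 (fun x => Real.log ‖x - a‖) unitDisk := by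
      intro a ha x hx
      have h0 : x - a ≠ 0 := sub_ne_zero.2 (ne_of_mem_unitDisk ha hx)
      have h1 : ContDiffAt ℝ 1 (fun x : ℂ => ‖x - a‖) x :=
        (contDiffAt_norm ℝ h0).comp x (contDiffAt_id.sub contDiffAt_const)
      exact (h1.log (norm_ne_zero_iff.2 h0)).contDiffWithinAt
    have h : HasWeakGradient (dipolePotential a b) (∇ (dipolePotential a b)) :=
      hasWeakGradient_of_contDiffOn (contDiffOn_const.mul ((hlog b hb).sub (hlog a ha)))
    intro φ hφ hc hs
    rw [h φ hφ hc hs]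
    congr 1
    refine setIntegral_congr_fun measurableSet_ball fun x hx => ?_
    rw [(hasGradientAt_dipolePotential ha hb hx).gradient]

/-! ### The weak equation of the dipole field, in polar coordinates at the source -/

/-- The isometry `y ↦ a (1 - y)` takes `0` to the boundary point `a`, so that polar coordinates at
the origin become polar coordinates at the pole. -/
lemma setIntegral_unitDisk_comp {a : ℂ} (ha : ‖a‖ = 1) (f : ℂ → ℝ) :
    ∫ x in unitDisk, f x = ∫ y in Metric.ball (1 : ℂ) 1, f (a * (1 - y)) := by
  let c : Circle := ⟨a, mem_sphere_zero_iff_norm.2 ha⟩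
  have hs : MeasurePreserving (fun y : ℂ => 1 - y) volume volume := by
    simpa [Function.comp_def, sub_eq_add_neg] using
      (measurePreserving_add_left (volume : Measure ℂ) 1).comp (Measure.measurePreserving_neg volume)
  have hm : MeasurePreserving (fun y : ℂ => a * (1 - y)) volume volume :=
    ((rotation c).measurePreserving).comp hs
  have he : MeasurableEmbedding (fun y : ℂ => a * (1 - y)) :=
    (rotation c).toHomeomorph.measurableEmbedding.comp
      (MeasurableEquiv.subLeft (1 : ℂ)).measurableEmbedding
  rw [← hm.setIntegral_preimage_emb he]
  congr 2
  ext y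
  simp [ha, dist_eq_norm, norm_sub_rev]

open Real in
-- The unit circle about `1` passes through the origin and has the polar equation `r = 2 cos t`.
lemma polar_mem_ball_iff {r t : ℝ} (hr : 0 < r) :
    (r : ℂ) * (Real.cos t + Real.sin t * Complex.I) ∈ Metric.ball (1 : ℂ) 1 ↔
      r < 2 * Real.cos t := by
  have h : ‖(r : ℂ) * (Real.cos t + Real.sin t * Complex.I) - 1‖ ^ 2 = r ^ 2 - 2 * r * cos t + 1 := by
    rw [← Complex.normSq_eq_norm_sq, Complex.normSq_apply]
    simp [-Complex.ofReal_cos, -Complex.ofReal_sin]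
    nlinarith [Real.sin_sq_add_cos_sq t]
  rw [Metric.mem_ball, dist_eq_norm, ← sq_lt_one_iff₀ (norm_nonneg _), h]
  constructor
  · intro h; nlinarith
  · intro h; nlinarith

/-- Polar coordinates centred at a boundary point: the pole of the field cancels against the
Jacobian, so that the radial integral is that of a derivative. -/
lemma integral_poleField_inner_gradient {a : ℂ} (ha : ‖a‖ = 1) {φ : ℂ → ℝ}
    (hφ : ContDiff ℝ ∞ φ) :
    ∫ x in unitDisk, inner ℝ (poleField a x) (∇ φ x) =
      (∫ t in (-(Real.pi / 2))..(Real.pi / 2), φ (-(a * Complex.exp (2 * t * Complex.I)))) -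
        Real.pi * φ a := by
  set E : ℝ → ℂ := fun t => Real.cos t + Real.sin t * Complex.I with hE
  have hEc : Continuous E := by fun_prop
  have hEn : ∀ t, ‖E t‖ = 1 := fun t => by
    have : E t = Complex.exp (t * Complex.I) := by simp [hE, Complex.exp_mul_I]
    rw [this, Complex.norm_exp_ofReal_mul_I]
  -- `D (r, t)` is the derivative in `r` of `φ (a (1 - r E t))`; it is what remains of the integrand
  -- after multiplication by the Jacobian `r`.
  set D : ℝ × ℝ → ℝ := fun p => fderiv ℝ φ (a * (1 - p.1 * E p.2)) (-(a * E p.2)) with hD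
  have hDc : Continuous D :=
    ((hφ.continuous_fderiv (by simp)).comp (by fun_prop)).clm_apply (by fun_prop)
  set S : Set (ℝ × ℝ) := {p | p.2 ∈ Set.Ioo (-(Real.pi / 2)) (Real.pi / 2) ∧
    0 < p.1 ∧ p.1 < 2 * Real.cos p.2} with hS
  have hSm : MeasurableSet S := by
    refine ((measurableSet_Ioo).preimage measurable_snd).inter ?_
    exact (measurableSet_lt measurable_const measurable_fst).inter
      (measurableSet_lt measurable_fst (by fun_prop))
  have hSb : S ⊆ Set.Icc 0 2 ×ˢ Set.Icc (-(Real.pi / 2)) (Real.pi / 2) := by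
    rintro ⟨r, t⟩ ⟨h1, h2, h3⟩
    exact ⟨⟨h2.le, h3.le.trans (by have := Real.cos_le_one t; linarith)⟩, h1.1.le, h1.2.le⟩
  have hDi : Integrable (S.indicator D) := by
    rw [integrable_indicator_iff hSm]
    exact (hDc.continuousOn.integrableOn_compact (isCompact_Icc.prod isCompact_Icc)).mono_set hSb
  have step1 : ∫ x in unitDisk, inner ℝ (poleField a x) (∇ φ x) = ∫ p, S.indicator D p := by
    rw [setIntegral_unitDisk_comp ha, ← integral_indicator measurableSet_ball,
      ← Complex.integral_comp_polarCoord_symm,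
      ← integral_indicator polarCoord.open_target.measurableSet]
    congr 1
    funext p
    obtain ⟨r, t⟩ := p
    by_cases hp : (r, t) ∈ S
    · have hr : 0 < r := hp.2.1
      have ht : (r, t) ∈ polarCoord.target := by
        have := hp.1
        simp only [polarCoord_target, Set.mem_prod, Set.mem_Ioi, Set.mem_Ioo] at this ⊢
        exact ⟨hr, by linarith [Real.pi_pos], by linarith [Real.pi_pos]⟩
      have hb : (r : ℂ) * E t ∈ Metric.ball (1 : ℂ) 1 := (polar_mem_ball_iff hr).2 hp.2.2
      rw [Set.indicator_of_mem ht, Set.indicator_of_mem hp, Complex.polarCoord_symm_apply,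
        Set.indicator_of_mem hb]
      have hpole : poleField a (a * (1 - r * E t)) = (r⁻¹ : ℝ) • (-(a * E t)) := by
        have h1 : a * (1 - r * E t) - a = (-r : ℝ) • (a * E t) := by
          rw [Complex.real_smul]; push_cast; ring
        have h2 : ‖a * E t‖ = 1 := by rw [norm_mul, ha, hEn, one_mul]
        have h3 : (starRingEnd ℂ (a * E t))⁻¹ = a * E t := by
          rw [Complex.inv_def, Complex.conj_conj, Complex.normSq_conj, Complex.normSq_eq_norm_sq,
            h2]; simp
        rw [poleField, h1, Complex.real_smul, map_mul, Complex.conj_ofReal, mul_inv, h3,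
          Complex.real_smul]
        push_cast
        rw [inv_neg]; ring
      rw [hpole, real_inner_smul_left, inner_gradient_right, smul_eq_mul,
        mul_inv_cancel_left₀ hr.ne']
      simp [hD]
    · rw [Set.indicator_of_notMem hp]
      by_cases ht : (r, t) ∈ polarCoord.target
      · rw [Set.indicator_of_mem ht]
        simp only [polarCoord_target, Set.mem_prod, Set.mem_Ioi, Set.mem_Ioo] at ht
        have hb : (r : ℂ) * E t ∉ Metric.ball (1 : ℂ) 1 := by
          intro hb
          have hlt : r < 2 * Real.cos t := (polar_mem_ball_iff ht.1).1 hb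
          have hcos : 0 < Real.cos t := by linarith [ht.1]
          refine hp ⟨⟨?_, ?_⟩, ht.1, hlt⟩
          · by_contra hc
            have := Real.cos_nonpos_of_pi_div_two_le_of_le (x := -t) (by simp at hc ⊢; linarith)
              (by linarith [Real.pi_pos])
            rw [Real.cos_neg] at this
            linarith
          · by_contra hc
            have := Real.cos_nonpos_of_pi_div_two_le_of_le (x := t) (by simp at hc ⊢; linarith)
              (by linarith [Real.pi_pos])
            linarith
        rw [Complex.polarCoord_symm_apply, Set.indicator_of_notMem hb, smul_zero]
      · rw [Set.indicator_of_notMem ht]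
  have inner_int : ∀ t ∈ Set.Ioo (-(Real.pi / 2)) (Real.pi / 2),
      ∫ r, S.indicator D (r, t) = φ (-(a * Complex.exp (2 * t * Complex.I))) - φ a := by
    intro t ht
    have hcos : 0 < Real.cos t := Real.cos_pos_of_mem_Ioo ht
    have h1 : (fun r => S.indicator D (r, t)) =
        (Set.Ioo 0 (2 * Real.cos t)).indicator fun r => D (r, t) := by
      funext r
      by_cases hr : r ∈ Set.Ioo 0 (2 * Real.cos t)
      · rw [Set.indicator_of_mem hr, Set.indicator_of_mem (show (r, t) ∈ S from ⟨ht, hr⟩)]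
      · rw [Set.indicator_of_notMem hr, Set.indicator_of_notMem fun h => hr h.2]
    rw [h1, integral_indicator measurableSet_Ioo, ← integral_Ioc_eq_integral_Ioo,
      ← intervalIntegral.integral_of_le (by positivity),
      intervalIntegral.integral_eq_sub_of_hasDerivAt (f := fun r : ℝ => φ (a * (1 - r * E t)))]
    -- The chord ends at `r = 2 cos t`, and `2 cos t * exp (i t) = 1 + exp (2 i t)`.
    · have h2 : a * (1 - (2 * Real.cos t : ℝ) * E t) = -(a * Complex.exp (2 * t * Complex.I)) := by
        have h3 : (2 * Real.cos t : ℝ) * E t = 1 + Complex.exp (2 * t * Complex.I) := by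
          have h4 : (E t) = Complex.exp (t * Complex.I) := by simp [hE, Complex.exp_mul_I]
          have h5 : ((2 * Real.cos t : ℝ) : ℂ) =
              Complex.exp (t * Complex.I) + Complex.exp (-t * Complex.I) := by
            push_cast; rw [Complex.two_cos]
          rw [h4, h5, add_mul, ← Complex.exp_add, ← Complex.exp_add, neg_mul, neg_add_cancel,
            Complex.exp_zero, add_comm]
          ring_nf
        rw [h3]; ring
      rw [h2]
      simp
    · intro r _
      have hd : HasDerivAt (fun r : ℝ => a * (1 - r * E t)) (-(a * E t)) r := by
        have := (((hasDerivAt_id r).ofReal_comp.mul_const (E t)).const_sub 1).const_mul a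
        simpa using this
      exact (hφ.differentiable (by simp) _).hasFDerivAt.comp_hasDerivAt r hd
    · exact (hDc.comp (by fun_prop)).intervalIntegrable _ _
  rw [step1, Measure.volume_eq_prod, integral_prod_symm _ (by rwa [← Measure.volume_eq_prod])]
  have h0 : ∀ t, t ∉ Set.Ioo (-(Real.pi / 2)) (Real.pi / 2) → ∫ r, S.indicator D (r, t) = 0 := by
    intro t ht
    have : (fun r => S.indicator D (r, t)) = fun _ => 0 := by
      funext r
      exact Set.indicator_of_notMem (fun h => ht h.1) _
    rw [this, integral_zero]
  rw [← setIntegral_eq_integral_of_forall_compl_eq_zero h0,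
    setIntegral_congr_fun measurableSet_Ioo inner_int, ← integral_Ioc_eq_integral_Ioo,
    ← intervalIntegral.integral_of_le (by linarith [Real.pi_pos]), intervalIntegral.integral_sub,
    intervalIntegral.integral_const]
  · simp
  · exact (hφ.continuous.comp (by fun_prop)).intervalIntegrable _ _
  · simp

/-- The exit points of the rays issuing from a boundary point are uniformly distributed on the
circle. -/
lemma integral_exit_point {a : ℂ} (ha : ‖a‖ = 1) (φ : ℂ → ℝ) :
    ∫ t in (-(Real.pi / 2))..(Real.pi / 2), φ (-(a * Complex.exp (2 * t * Complex.I))) =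
      (1 / 2) * ∫ t in (0 : ℝ)..(2 * Real.pi), φ (Complex.exp (t * Complex.I)) := by
  have hp : Function.Periodic (fun t : ℝ => φ (Complex.exp (t * Complex.I))) (2 * Real.pi) := by
    intro t
    simp only
    congr 1
    push_cast
    rw [add_mul, Complex.exp_add, Complex.exp_two_pi_mul_I, mul_one]
  -- The substitution `s = 2 t + arg (-a)` turns the half circle of directions into one full period;
  -- its Jacobian gives the factor `1 / 2`.
  have hna : -a = Complex.exp ((-a).arg * Complex.I) := by
    have := Complex.norm_mul_exp_arg_mul_I (-a)
    rw [norm_neg, ha] at this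
    simpa using this.symm
  have h1 : ∀ t : ℝ, φ (-(a * Complex.exp (2 * t * Complex.I))) =
      (fun t : ℝ => φ (Complex.exp (t * Complex.I))) (2 * t + (-a).arg) := by
    intro t
    simp only
    have h2 : -a * Complex.exp (2 * t * Complex.I) =
        Complex.exp ((2 * t + (-a).arg : ℝ) * Complex.I) := by
      nth_rw 1 [hna]
      rw [← Complex.exp_add]
      congr 1
      push_cast; ring
    rw [← neg_mul, h2]
  rw [intervalIntegral.integral_congr fun t _ => h1 t,
    intervalIntegral.integral_comp_mul_add (fun t : ℝ => φ (Complex.exp (t * Complex.I)))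
      two_ne_zero]
  have := hp.intervalIntegral_add_eq (2 * -(Real.pi / 2) + (-a).arg) 0
  rw [zero_add] at this
  rw [← this, smul_eq_mul, one_div]
  congr 2
  ring

/-- The integral over the exit points does not depend on the source, so it cancels between the two
poles. Only `π (φ a - φ b)` is left, which accounts for the factor `π⁻¹` and the order of the poles
in `dipoleField`. -/
lemma integral_dipoleField_inner_gradient {a b : ℂ} (ha : ‖a‖ = 1) (hb : ‖b‖ = 1) {φ : ℂ → ℝ}
    (hφ : ContDiff ℝ ∞ φ) :
    ∫ x in unitDisk, inner ℝ (dipoleField a b x) (∇ φ x) = φ a - φ b := by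
  have hi := fun a => integrable_inner_of_continuous (integrable_poleField a)
    (continuous_gradient hφ)
  simp only [dipoleField, real_inner_smul_left, inner_sub_left]
  rw [integral_const_mul, integral_sub (hi b) (hi a), integral_poleField_inner_gradient ha hφ,
    integral_poleField_inner_gradient hb hφ, integral_exit_point ha, integral_exit_point hb,
    sub_sub_sub_cancel_left, ← mul_sub, inv_mul_cancel_left₀ Real.pi_ne_zero]

lemma integral_dipole (θ η : ℝ) (φ : ℂ → ℝ) :
    ∫ᵛ y : DiskBoundary, φ (y : ℂ) ∂•(dipole θ η : SignedMeasure DiskBoundary) =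
      φ (boundaryPoint θ) - φ (boundaryPoint η) := by
  have hi : ∀ θ : ℝ, (VectorMeasure.dirac (boundaryPoint θ) (1 : ℝ)).Integrable
      fun y : DiskBoundary => φ (y : ℂ) := by
    intro θ
    rw [VectorMeasure.Integrable, VectorMeasure.variation_dirac]
    exact (integrable_dirac (by simp)).smul_measure (by simp)
  rw [dipole, VectorMeasure.integral_sub_vectorMeasure (hi θ) (hi η),
    VectorMeasure.integral_dirac, VectorMeasure.integral_dirac]
  simp

lemma norm_boundaryPoint (θ : ℝ) : ‖(boundaryPoint θ : ℂ)‖ = 1 := by simp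

lemma isBackgroundPotential_dipole (θ η : ℝ) :
    IsBackgroundPotential (dipole θ η) (dipolePotential (boundaryPoint θ) (boundaryPoint η))
      (dipoleField (boundaryPoint θ) (boundaryPoint η)) where
  memSobolev := memSobolev_dipole (norm_boundaryPoint θ) (norm_boundaryPoint η)
  weak_eq φ hφ := by
    simp only [one_mul]
    rw [integral_dipole, integral_dipoleField_inner_gradient (norm_boundaryPoint θ)
      (norm_boundaryPoint η) hφ]

/-! ### Uniqueness for integrable curl-free fields with zero Neumann data -/

open ComplexConjugate

/-- `G` is curl-free in the disk, in the sense of distributions. -/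
def IsCurlFree (G : ℂ → ℂ) : Prop :=
  ∀ ψ : ℂ → ℝ, ContDiff ℝ ∞ ψ → HasCompactSupport ψ → tsupport ψ ⊆ unitDisk →
    ∫ x in unitDisk, inner ℝ (Complex.I * G x) (∇ ψ x) = 0

/-- The Cauchy-Riemann operator `∂_x + i ∂_y`. -/
noncomputable def dbar (χ : ℂ → ℂ) (x : ℂ) : ℂ := fderiv ℝ χ x 1 + fderiv ℝ χ x Complex.I * Complex.I

lemma continuous_dbar {χ : ℂ → ℂ} (hχ : ContDiff ℝ ∞ χ) : Continuous (dbar χ) := by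
  have := hχ.continuous_fderiv (by simp)
  unfold dbar
  fun_prop

lemma dbar_eq_gradient {χ : ℂ → ℂ} {x : ℂ} (hχ : DifferentiableAt ℝ χ x) :
    dbar χ x = ∇ (fun y => (χ y).re) x + Complex.I * ∇ (fun y => (χ y).im) x := by
  have h1 : fderiv ℝ (fun y => (χ y).re) x = Complex.reCLM ∘L fderiv ℝ χ x :=
    (Complex.reCLM.hasFDerivAt.comp x hχ.hasFDerivAt).fderiv
  have h2 : fderiv ℝ (fun y => (χ y).im) x = Complex.imCLM ∘L fderiv ℝ χ x :=
    (Complex.imCLM.hasFDerivAt.comp x hχ.hasFDerivAt).fderiv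
  rw [gradient_eq_fderiv, gradient_eq_fderiv, h1, h2, dbar]
  apply Complex.ext <;> simp
  ring

lemma dbar_mul {χ η : ℂ → ℂ} {x : ℂ} (hχ : DifferentiableAt ℝ χ x) (hη : DifferentiableAt ℝ η x) :
    dbar (fun y => χ y * η y) x = χ x * dbar η x + η x * dbar χ x := by
  simp only [dbar]
  rw [fderiv_fun_mul hχ hη]
  simp
  ring

lemma dbar_sub {χ η : ℂ → ℂ} {x : ℂ} (hχ : DifferentiableAt ℝ χ x) (hη : DifferentiableAt ℝ η x) :
    dbar (fun y => χ y - η y) x = dbar χ x - dbar η x := by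
  simp only [dbar]
  rw [fderiv_fun_sub hχ hη]
  simp
  ring

lemma hasFDerivAt_conj_pow (n : ℕ) (x : ℂ) :
    HasFDerivAt (fun y : ℂ => conj y ^ n) ((n * conj x ^ (n - 1)) • (Complex.conjCLE : ℂ →L[ℝ] ℂ))
      x := by
  have := (Complex.conjCLE : ℂ →L[ℝ] ℂ).hasFDerivAt (x := x) |>.pow n
  refine HasFDerivAt.congr_fderiv (f := fun y : ℂ => conj y ^ n) this ?_
  ext v
  simp

lemma dbar_conj_pow (n : ℕ) (x : ℂ) : dbar (fun y => conj y ^ n) x = 2 * n * conj x ^ (n - 1) := by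
  rw [dbar, (hasFDerivAt_conj_pow n x).fderiv]
  simp
  ring_nf
  simp
  ring

lemma dbar_pow (n : ℕ) (x : ℂ) : dbar (fun y => y ^ n) x = 0 := by
  have := (hasDerivAt_pow n x).complexToReal_fderiv.fderiv
  rw [dbar, this]
  simp [mul_assoc]

lemma contDiff_conj : ContDiff ℝ ∞ (fun y : ℂ => conj y) := Complex.conjCLE.contDiff

lemma integrable_conj {G : ℂ → ℂ} (hG : Integrable G diskMeasure) :
    Integrable (fun x => conj (G x)) diskMeasure :=
  Complex.conjCLE.toContinuousLinearMap.integrable_comp hG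

/-- Together with `conj_mul_im`, this packs both conditions on `G` into the complex integral of
`conj G * ∇φ`: the real part is the Neumann pairing, the imaginary part the curl pairing. -/
lemma conj_mul_re (z w : ℂ) : (conj z * w).re = inner ℝ z w := by
  simp [Complex.inner, mul_comm]

lemma conj_mul_im (z w : ℂ) : (conj z * w).im = inner ℝ (Complex.I * z) w := by
  simp [Complex.inner]; ring

lemma deriv_smoothTransition_of_one_lt {t : ℝ} (h1 : 1 < t) : deriv Real.smoothTransition t = 0 := by
  have : Real.smoothTransition =ᶠ[nhds t] fun _ => 1 := by
    filter_upwards [lt_mem_nhds h1] with y hy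
    exact Real.smoothTransition.one_of_one_le hy.le
  rw [this.deriv_eq, deriv_const]

/-- The derivative lives on `[0, 1]`. The weight `t + 1` becomes `k (1 - |x|²)` for the cut-offs of
`integral_conj_mul_dbar_of_vanishing`. -/
lemma exists_bound_deriv_smoothTransition :
    ∃ M, 0 ≤ M ∧ ∀ t, |(t + 1) * deriv Real.smoothTransition t| ≤ M := by
  have hcont : Continuous (deriv Real.smoothTransition) :=
    (Real.smoothTransition.contDiff (n := 1)).continuous_deriv (by simp)
  obtain ⟨M, hM⟩ := (isCompact_Icc (a := (0 : ℝ)) (b := 1)).exists_bound_of_continuousOn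
    (f := fun t => (t + 1) * deriv Real.smoothTransition t) (by fun_prop)
  refine ⟨max M 0, le_max_right _ _, fun t => ?_⟩
  by_cases ht : t ∈ Set.Icc (0 : ℝ) 1
  · exact (hM t ht).trans (le_max_left _ _)
  · have : deriv Real.smoothTransition t = 0 := by
      by_cases h0 : 0 ≤ t
      · exact deriv_smoothTransition_of_one_lt (by by_contra h; exact ht ⟨h0, by linarith⟩)
      · have : Real.smoothTransition =ᶠ[nhds t] fun _ => 0 := by
          filter_upwards [gt_mem_nhds (not_le.1 h0)] with y hy
          exact Real.smoothTransition.zero_of_nonpos hy.le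
        rw [this.deriv_eq, deriv_const]
    simp [this]

lemma one_sub_sq_pow_le (t : ℝ) (n : ℕ) :
    1 - (t ^ 2) ^ n ≤ n * (1 - t ^ 2) := by
  have := one_add_mul_le_pow (a := t ^ 2 - 1) (by nlinarith [sq_nonneg t]) n
  rw [add_sub_cancel] at this
  linarith

lemma norm_mul_sub_one_le {x p : ℂ} (hx : x ∈ unitDisk) (hp : ‖p‖ ≤ 1) (n : ℕ) :
    ‖p * ((x * conj x) ^ n - 1)‖ ≤ n * (1 - ‖x‖ ^ 2) := by
  have hx1 : ‖x‖ ≤ 1 := (mem_ball_zero_iff.1 hx).le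
  have h : ‖(x * conj x) ^ n - 1‖ = 1 - (‖x‖ ^ 2) ^ n := by
    have h1 : (‖x‖ ^ 2) ^ n ≤ 1 := pow_le_one₀ (by positivity) (pow_le_one₀ (norm_nonneg _) hx1)
    rw [Complex.mul_conj, Complex.normSq_eq_norm_sq, ← Complex.ofReal_pow, ← Complex.ofReal_one,
      ← Complex.ofReal_sub, Complex.norm_real, Real.norm_eq_abs, abs_sub_comm,
      abs_of_nonneg (by linarith)]
  rw [norm_mul, h]
  exact (mul_le_of_le_one_left (by rw [← h]; positivity) hp).trans
    (one_sub_sq_pow_le _ n)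

section
variable {G : ℂ → ℂ} (hG : Integrable G diskMeasure) (hc : IsCurlFree G)
  (hN : ∀ φ : ℂ → ℝ, ContDiff ℝ ∞ φ → ∫ x in unitDisk, inner ℝ (G x) (∇ φ x) = 0)
include hG hN

lemma integral_conj_mul_gradient_re {φ : ℂ → ℝ} (hφ : ContDiff ℝ ∞ φ) :
    (∫ x in unitDisk, conj (G x) * ∇ φ x).re = 0 := by
  have hi := integrable_mul_of_continuous (integrable_conj hG) (continuous_gradient hφ)
  have := integral_re hi
  simp only [RCLike.re_to_complex, conj_mul_re] at this
  rw [← this, hN φ hφ]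

include hc

lemma integral_conj_mul_gradient {φ : ℂ → ℝ} (hφ : ContDiff ℝ ∞ φ) (hφc : HasCompactSupport φ)
    (hs : tsupport φ ⊆ unitDisk) : ∫ x in unitDisk, conj (G x) * ∇ φ x = 0 := by
  have hi := integrable_mul_of_continuous (integrable_conj hG) (continuous_gradient hφ)
  apply Complex.ext
  · exact integral_conj_mul_gradient_re hG hN hφ
  · have := integral_im hi
    simp only [RCLike.im_to_complex, conj_mul_im] at this
    rw [← this, hc φ hφ hφc hs]; rfl

lemma integral_conj_mul_dbar_of_hasCompactSupport {χ : ℂ → ℂ} (hχ : ContDiff ℝ ∞ χ)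
    (hχc : HasCompactSupport χ) (hs : tsupport χ ⊆ unitDisk) :
    ∫ x in unitDisk, conj (G x) * dbar χ x = 0 := by
  have hre : ContDiff ℝ ∞ (fun y => (χ y).re) := Complex.reCLM.contDiff.comp hχ
  have him : ContDiff ℝ ∞ (fun y => (χ y).im) := Complex.imCLM.contDiff.comp hχ
  have hsre : tsupport (fun y => (χ y).re) ⊆ tsupport χ :=
    closure_mono (Function.support_comp_subset (g := Complex.re) rfl χ)
  have hsim : tsupport (fun y => (χ y).im) ⊆ tsupport χ :=
    closure_mono (Function.support_comp_subset (g := Complex.im) rfl χ)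
  have e : ∀ x, conj (G x) * dbar χ x = conj (G x) * ∇ (fun y => (χ y).re) x +
      Complex.I * (conj (G x) * ∇ (fun y => (χ y).im) x) := fun x => by
    rw [dbar_eq_gradient (hχ.differentiable (by simp) x)]; ring
  simp only [e]
  rw [integral_add (integrable_mul_of_continuous (integrable_conj hG) (continuous_gradient hre))
    ((integrable_mul_of_continuous (integrable_conj hG) (continuous_gradient him)).const_mul _),
    integral_const_mul,
    integral_conj_mul_gradient hG hc hN hre (hχc.mono' (subset_closure.trans hsre))
      (hsre.trans hs),
    integral_conj_mul_gradient hG hc hN him (hχc.mono' (subset_closure.trans hsim))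
      (hsim.trans hs)]
  simp

/-- The orthogonality relation extends to test functions which vanish to first order at the
boundary. -/
lemma integral_conj_mul_dbar_of_vanishing {χ : ℂ → ℂ} (hχ : ContDiff ℝ ∞ χ) {C : ℝ}
    (hC : ∀ x ∈ unitDisk, ‖χ x‖ ≤ C * (1 - ‖x‖ ^ 2)) :
    ∫ x in unitDisk, conj (G x) * dbar χ x = 0 := by
  obtain ⟨M, hM0, hM⟩ := exists_bound_deriv_smoothTransition
  obtain ⟨B, hB0, hB⟩ := exists_norm_le_of_continuous (continuous_dbar hχ)
  -- The cut-off `η k` vanishes where `1 - |x|² ≤ 1 / k` and equals `1` where `1 - |x|² ≥ 2 / k`. In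
  -- between its gradient is `O(k)` while `χ` is `O(1 / k)`, so `∂̄(η χ)` stays bounded and
  -- dominated convergence applies.
  set s : ℕ → ℂ → ℝ := fun k x => k * (1 - ‖x‖ ^ 2) - 1 with hs
  set η : ℕ → ℂ → ℝ := fun k x => Real.smoothTransition (s k x) with hη
  have hsd : ∀ k, ContDiff ℝ ∞ (s k) := fun k =>
    (contDiff_const.mul (contDiff_const.sub (contDiff_norm_sq ℝ))).sub contDiff_const
  have hηd : ∀ k, ContDiff ℝ ∞ (η k) := fun k => Real.smoothTransition.contDiff.comp (hsd k)
  have hηf : ∀ k x, HasFDerivAt (fun x => (η k x : ℂ)) (Complex.ofRealCLM ∘L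
      (deriv Real.smoothTransition (s k x) • ((k : ℝ) • (-((2 : ℝ) • innerSL ℝ x))))) x := by
    intro k x
    have h1 : HasFDerivAt (s k) ((k : ℝ) • (-((2 : ℝ) • innerSL ℝ x))) x := by
      have := (((hasFDerivAt_id x).norm_sq.const_sub 1).const_mul (k : ℝ)).sub_const 1
      refine this.congr_fderiv ?_
      ext v; simp [two_smul]
    have h2 := ((Real.smoothTransition.contDiffAt (n := 1)).differentiableAt
      (by simp) (x := s k x)).hasDerivAt.comp_hasFDerivAt x h1
    exact Complex.ofRealCLM.hasFDerivAt.comp x h2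
  have hηb : ∀ k x, dbar (fun x => (η k x : ℂ)) x =
      -(2 * k * deriv Real.smoothTransition (s k x) : ℝ) * x := by
    intro k x
    rw [dbar, (hηf k x).fderiv]
    apply Complex.ext <;> simp <;> ring
  have hηs : ∀ k, tsupport (fun x => (η k x : ℂ)) ⊆ {x | 0 ≤ s k x} := by
    intro k
    refine closure_minimal (fun x hx => ?_)
      (isClosed_le continuous_const (hsd k).continuous)
    by_contra h
    exact hx (by simp [hη, Real.smoothTransition.zero_of_nonpos (not_le.1 h).le])
  have hsub : ∀ k, {x | 0 ≤ s k x} ⊆ unitDisk := by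
    intro k x hx
    have h0 : 0 ≤ k * (1 - ‖x‖ ^ 2) - 1 := hx
    have h1 : 0 < 1 - ‖x‖ ^ 2 := by
      by_contra h
      nlinarith [(Nat.cast_nonneg k : (0 : ℝ) ≤ k)]
    rw [mem_ball_zero_iff, ← sq_lt_one_iff₀ (norm_nonneg _)]
    linarith
  have hcs : ∀ k, HasCompactSupport (fun x => (η k x : ℂ) * χ x) := fun k =>
    HasCompactSupport.mul_right ((isCompact_closedBall (0 : ℂ) 1).of_isClosed_subset
      (isClosed_tsupport _) ((hηs k).trans ((hsub k).trans Metric.ball_subset_closedBall)))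
  have hzero : ∀ k, ∫ x in unitDisk, conj (G x) * dbar (fun x => (η k x : ℂ) * χ x) x = 0 := by
    intro k
    exact integral_conj_mul_dbar_of_hasCompactSupport hG hc hN
      ((Complex.ofRealCLM.contDiff.comp (hηd k)).mul hχ) (hcs k)
      (tsupport_mul_subset_left.trans ((hηs k).trans (hsub k)))
  have hexp : ∀ k x, dbar (fun x => (η k x : ℂ) * χ x) x = η k x * dbar χ x +
      χ x * (-(2 * k * deriv Real.smoothTransition (s k x) : ℝ) * x) := fun k x => by
    rw [dbar_mul (hηf k x).differentiableAt (hχ.differentiable (by simp) x), hηb]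
  have hbound : ∀ k, ∀ x ∈ unitDisk, ‖dbar (fun x => (η k x : ℂ) * χ x) x‖ ≤ B + 2 * C * M := by
    intro k x hx
    have hx1 : ‖x‖ ≤ 1 := (mem_ball_zero_iff.1 hx).le
    rw [hexp]
    refine (norm_add_le _ _).trans (add_le_add ?_ ?_)
    · rw [norm_mul, Complex.norm_real, Real.norm_eq_abs,
        abs_of_nonneg (Real.smoothTransition.nonneg _)]
      exact (mul_le_of_le_one_left (norm_nonneg _) (Real.smoothTransition.le_one _)).trans (hB x hx)
    · have hCx := hC x hx
      have hd : 0 < 1 - ‖x‖ ^ 2 := by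
        have := (sq_lt_one_iff₀ (norm_nonneg x)).2 (mem_ball_zero_iff.1 hx)
        linarith
      have hC0 : 0 ≤ C := by
        by_contra h
        nlinarith [norm_nonneg (χ x)]
      have h3 := hM (s k x)
      rw [show s k x + 1 = k * (1 - ‖x‖ ^ 2) by simp [hs], abs_mul, abs_mul, Nat.abs_cast,
        abs_of_pos hd] at h3
      rw [norm_mul, norm_mul, norm_neg, Complex.norm_real, Real.norm_eq_abs, abs_mul, abs_mul,
        Nat.abs_cast, abs_two]
      calc ‖χ x‖ * (2 * k * |deriv Real.smoothTransition (s k x)| * ‖x‖)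
          ≤ C * (1 - ‖x‖ ^ 2) * (2 * k * |deriv Real.smoothTransition (s k x)| * 1) := by
            gcongr
        _ = 2 * C * (k * (1 - ‖x‖ ^ 2) * |deriv Real.smoothTransition (s k x)|) := by ring
        _ ≤ 2 * C * M := by gcongr
  have hlim : ∀ x ∈ unitDisk, Filter.Tendsto (fun k => dbar (fun x => (η k x : ℂ) * χ x) x)
      Filter.atTop (nhds (dbar χ x)) := by
    intro x hx
    have hd : 0 < 1 - ‖x‖ ^ 2 := by
      have := (sq_lt_one_iff₀ (norm_nonneg x)).2 (mem_ball_zero_iff.1 hx)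
      linarith
    have ht : Filter.Tendsto (fun k : ℕ => (k : ℝ) * (1 - ‖x‖ ^ 2)) Filter.atTop Filter.atTop :=
      tendsto_natCast_atTop_atTop.atTop_mul_const hd
    refine Filter.Tendsto.congr' ?_ tendsto_const_nhds
    filter_upwards [ht.eventually_gt_atTop 2] with k hk
    have h1 : 1 < s k x := by simp only [hs]; linarith
    rw [hexp, deriv_smoothTransition_of_one_lt h1]
    simp [hη, Real.smoothTransition.one_of_one_le h1.le]
  have hmeas : ∀ k, Continuous (dbar (fun x => (η k x : ℂ) * χ x)) := fun k =>
    continuous_dbar ((Complex.ofRealCLM.contDiff.comp (hηd k)).mul hχ)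
  have hconv := tendsto_integral_of_dominated_convergence
    (μ := diskMeasure) (F := fun k x => conj (G x) * dbar (fun x => (η k x : ℂ) * χ x) x)
    (f := fun x => conj (G x) * dbar χ x) (fun x => ‖G x‖ * (B + 2 * C * M))
    (fun k => (integrable_conj hG).aestronglyMeasurable.mul (hmeas k).aestronglyMeasurable)
    (hG.norm.mul_const _)
    (fun k => by
      filter_upwards [ae_mem_unitDisk] with x hx
      rw [norm_mul, RCLike.norm_conj]
      gcongr
      exact hbound k x hx)
    (by
      filter_upwards [ae_mem_unitDisk] with x hx
      exact (hlim x hx).const_mul _)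
  simp only [hzero] at hconv
  exact (tendsto_nhds_unique hconv tendsto_const_nhds)

-- The Neumann condition admits test functions that do not vanish on the boundary: `Re (c (conj
-- x)^(k+1))` has gradient `c (k+1) (conj x)^k`. Since `c` is arbitrary, the choice `c = conj J`
-- controls the whole complex number `J`, not just its real part.
omit hc in
lemma integral_conj_mul_conj_pow (k : ℕ) : ∫ x in unitDisk, conj (G x) * conj x ^ k = 0 := by
  set J := ∫ x in unitDisk, conj (G x) * conj x ^ k with hJ
  have key : ∀ c : ℂ, (c * J).re = 0 := by
    intro c
    have hf : ∀ x, HasFDerivAt (fun y : ℂ => (c * conj y ^ (k + 1)).re)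
        (Complex.reCLM ∘L (c • (((k + 1 : ℕ) * conj x ^ k : ℂ) •
          (Complex.conjCLE : ℂ →L[ℝ] ℂ)))) x := fun x =>
      Complex.reCLM.hasFDerivAt.comp x ((hasFDerivAt_conj_pow (k + 1) x).const_mul c)
    have hg : ∀ x, ∇ (fun y : ℂ => (c * conj y ^ (k + 1)).re) x =
        c * ((k + 1 : ℕ) * conj x ^ k) := by
      intro x
      rw [gradient_eq_fderiv, (hf x).fderiv]
      apply Complex.ext <;> simp [add_comm]
    have hd : ContDiff ℝ ∞ (fun y : ℂ => (c * conj y ^ (k + 1)).re) :=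
      Complex.reCLM.contDiff.comp (contDiff_const.mul (contDiff_conj.pow _))
    have h1 := integral_conj_mul_gradient_re hG hN hd
    simp only [hg] at h1
    have h2 : ∀ x, conj (G x) * (c * ((k + 1 : ℕ) * conj x ^ k)) =
        ((k + 1 : ℝ) : ℂ) * (c * (conj (G x) * conj x ^ k)) := fun x => by push_cast; ring
    simp only [h2] at h1
    rw [integral_const_mul, integral_const_mul, Complex.re_ofReal_mul] at h1
    exact (mul_eq_zero.1 h1).resolve_left (by positivity)
  have h := key (conj J)
  rw [← Complex.normSq_eq_conj_mul_self, Complex.ofReal_re] at h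
  exact Complex.normSq_eq_zero.1 h

/-- Up to a factor the monomial is `∂̄` of `x^m (conj x)^(n+1)`, which on the unit circle agrees
with `(conj x)^(n+1-m)` or `x^(m-n-1)`. Subtracting that power makes the test function vanish to
first order at the boundary; the subtracted term contributes a power of `conj x`, already treated,
or a holomorphic function, killed by `∂̄`. -/
lemma integral_conj_mul_monomial (m n : ℕ) :
    ∫ x in unitDisk, conj (G x) * (x ^ m * conj x ^ n) = 0 := by
  have hpow : ∀ m : ℕ, ContDiff ℝ ∞ (fun x : ℂ => x ^ m) := fun m => contDiff_id.pow m
  have hcpow : ∀ m : ℕ, ContDiff ℝ ∞ (fun x : ℂ => conj x ^ m) := fun m => contDiff_conj.pow m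
  have hd : ∀ {f : ℂ → ℂ}, ContDiff ℝ ∞ f → ∀ x, DifferentiableAt ℝ f x := fun hf x =>
    hf.differentiable (by simp) x
  have hmain : ContDiff ℝ ∞ (fun x : ℂ => x ^ m * conj x ^ (n + 1)) := (hpow m).mul (hcpow (n + 1))
  have hb : ∀ x, dbar (fun x => x ^ m * conj x ^ (n + 1)) x =
      2 * (n + 1) * (x ^ m * conj x ^ n) := fun x => by
    rw [dbar_mul (hd (hpow m) x) (hd (hcpow (n + 1)) x), dbar_conj_pow, dbar_pow]
    push_cast
    simp
    ring
  have hn : (2 * (n + 1) : ℂ) ≠ 0 := by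
    have : ((n : ℂ) + 1) ≠ 0 := by exact_mod_cast n.succ_ne_zero
    simp [this]
  rcases le_or_gt m n with h | h
  · obtain ⟨l, rfl⟩ := Nat.exists_eq_add_of_le h
    have h0 := integral_conj_mul_dbar_of_vanishing hG hc hN (C := m)
      (hmain.sub (hcpow (l + 1))) (fun x hx => by
        have : x ^ m * conj x ^ (m + l + 1) - conj x ^ (l + 1) =
            conj x ^ (l + 1) * ((x * conj x) ^ m - 1) := by ring
        rw [this]
        refine norm_mul_sub_one_le hx ?_ m
        rw [norm_pow, RCLike.norm_conj]
        exact pow_le_one₀ (norm_nonneg _) (mem_ball_zero_iff.1 hx).le)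
    have e : ∀ x, conj (G x) * dbar (fun x => x ^ m * conj x ^ (m + l + 1) - conj x ^ (l + 1)) x =
        (2 * ((m + l : ℕ) + 1)) * (conj (G x) * (x ^ m * conj x ^ (m + l))) -
          (2 * (l + 1)) * (conj (G x) * conj x ^ l) := fun x => by
      rw [dbar_sub (hd hmain x) (hd (hcpow _) x), hb, dbar_conj_pow, Nat.add_sub_cancel]
      push_cast
      ring
    simp only [e] at h0
    rw [integral_sub, integral_const_mul, integral_const_mul, integral_conj_mul_conj_pow hG hN,
      mul_zero, sub_zero] at h0
    · exact (mul_eq_zero.1 h0).resolve_left hn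
    · exact (integrable_mul_of_continuous (integrable_conj hG)
        ((hpow m).mul (hcpow (m + l))).continuous).const_mul _
    · exact (integrable_mul_of_continuous (integrable_conj hG) (hcpow l).continuous).const_mul _
  · obtain ⟨l, rfl⟩ := Nat.exists_eq_add_of_lt h
    have h0 := integral_conj_mul_dbar_of_vanishing hG hc hN (C := (n + 1 : ℕ))
      (hmain.sub (hpow l)) (fun x hx => by
        have : x ^ (n + l + 1) * conj x ^ (n + 1) - x ^ l =
            x ^ l * ((x * conj x) ^ (n + 1) - 1) := by ring
        rw [this]
        refine norm_mul_sub_one_le hx ?_ (n + 1)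
        rw [norm_pow]
        exact pow_le_one₀ (norm_nonneg _) (mem_ball_zero_iff.1 hx).le)
    have e : ∀ x, conj (G x) * dbar (fun x => x ^ (n + l + 1) * conj x ^ (n + 1) - x ^ l) x =
        (2 * (n + 1)) * (conj (G x) * (x ^ (n + l + 1) * conj x ^ n)) := fun x => by
      rw [dbar_sub (hd hmain x) (hd (hpow _) x), hb, dbar_pow]
      ring
    simp only [e] at h0
    rw [integral_const_mul] at h0
    exact (mul_eq_zero.1 h0).resolve_left hn

/-- Stone-Weierstrass: polynomials in `x` and `conj x` are uniformly dense on the closed disk, and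
the pairing with an integrable field is continuous for the uniform norm. -/
lemma integral_conj_mul_continuous {f : ℂ → ℂ} (hf : Continuous f) :
    ∫ x in unitDisk, conj (G x) * f x = 0 := by
  let K : Set ℂ := Metric.closedBall 0 1
  have hK : CompactSpace K := isCompact_iff_compactSpace.1 (isCompact_closedBall 0 1)
  have hiK : ∀ x ∈ unitDisk, x ∈ K := fun x hx => Metric.ball_subset_closedBall hx
  have hi : ∀ {f : ℂ → ℂ}, Continuous f → Integrable (fun x => conj (G x) * f x) diskMeasure :=
    fun hf => integrable_mul_of_continuous (integrable_conj hG) hf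
  let X : C(K, ℂ) := ContinuousMap.restrict K (.id ℂ)
  -- every element of the star algebra generated by the coordinate is a polynomial in `x`, `conj x`
  have hA : ∀ p ∈ StarAlgebra.adjoin ℂ {X}, ∃ q : ℂ → ℂ, Continuous q ∧ (∀ x : K, p x = q x) ∧
      ∫ x in unitDisk, conj (G x) * q x = 0 := by
    intro p hp
    have hp' : p ∈ Submodule.span ℂ (Submonoid.closure ({X, star X} : Set C(K, ℂ)) : Set C(K, ℂ)) := by
      rw [← Algebra.adjoin_eq_span]
      have : p ∈ (StarAlgebra.adjoin ℂ {X}).toSubalgebra := hp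
      rw [StarAlgebra.adjoin_toSubalgebra] at this
      simpa [Set.star_singleton, Set.singleton_union, Set.pair_comm] using this
    clear hp
    induction hp' using Submodule.span_induction with
    | mem p hp =>
      obtain ⟨m, n, rfl⟩ := (Submonoid.mem_closure_pair _ _ _).1 hp
      exact ⟨fun x => x ^ m * conj x ^ n, by fun_prop, fun x => by simp [X],
        integral_conj_mul_monomial hG hc hN m n⟩
    | zero => exact ⟨fun _ => 0, by fun_prop, by simp, by simp⟩
    | add p p' _ _ h h' =>
      obtain ⟨q, hq, hpq, h0⟩ := h
      obtain ⟨q', hq', hpq', h0'⟩ := h'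
      refine ⟨fun x => q x + q' x, by fun_prop, fun x => by simp [hpq, hpq'], ?_⟩
      simp only [mul_add]
      rw [integral_add (hi hq) (hi hq'), h0, h0', add_zero]
    | smul c p _ h =>
      obtain ⟨q, hq, hpq, h0⟩ := h
      refine ⟨fun x => c * q x, by fun_prop, fun x => by simp [hpq], ?_⟩
      simp only [mul_left_comm _ c]
      rw [integral_const_mul, h0, mul_zero]
  have hdense : ContinuousMap.restrict K ⟨f, hf⟩ ∈
      closure (StarAlgebra.adjoin ℂ {X} : Set C(K, ℂ)) := by
    have : ContinuousMap.restrict K ⟨f, hf⟩ ∈ StarAlgebra.elemental ℂ X := by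
      rw [ContinuousMap.elemental_id_eq_top]; trivial
    exact this
  have hbound : ∀ ε > 0, ‖∫ x in unitDisk, conj (G x) * f x‖ ≤ (∫ x in unitDisk, ‖G x‖) * ε := by
    intro ε hε
    obtain ⟨p, hp, hfp⟩ := Metric.mem_closure_iff.1 hdense ε hε
    obtain ⟨q, hq, hpq, h0⟩ := hA p hp
    rw [← sub_zero (∫ x in unitDisk, conj (G x) * f x), ← h0, ← integral_sub (hi hf) (hi hq),
      ← integral_mul_const]
    refine norm_integral_le_of_norm_le (hG.norm.mul_const ε) ?_
    filter_upwards [ae_mem_unitDisk] with x hx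
    rw [← mul_sub, norm_mul, RCLike.norm_conj]
    gcongr
    have := (ContinuousMap.dist_apply_le_dist (f := ContinuousMap.restrict K ⟨f, hf⟩) (g := p)
      ⟨x, hiK x hx⟩).trans hfp.le
    rw [hpq, dist_eq_norm] at this
    exact this
  have hlim : Filter.Tendsto (fun ε => (∫ x in unitDisk, ‖G x‖) * ε) (nhdsWithin 0 (Set.Ioi 0))
      (nhds 0) := by
    have : Filter.Tendsto (fun ε => (∫ x in unitDisk, ‖G x‖) * ε) (nhds 0)
        (nhds ((∫ x in unitDisk, ‖G x‖) * 0)) := (continuous_const_mul _).tendsto 0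
    rw [mul_zero] at this
    exact this.mono_left nhdsWithin_le_nhds
  exact norm_le_zero_iff.1 (ge_of_tendsto hlim (eventually_mem_nhdsWithin.mono hbound))

theorem ae_eq_zero_of_isCurlFree : ∀ᵐ x ∂diskMeasure, G x = 0 := by
  rw [ae_restrict_iff' measurableSet_ball]
  refine Metric.isOpen_ball.ae_eq_zero_of_integral_contDiff_smul_eq_zero
    (IntegrableOn.locallyIntegrableOn hG) fun g hg hgc hgs => ?_
  have h1 := integral_conj_mul_continuous hG hc hN (f := fun x => (g x : ℂ))
    (Complex.continuous_ofReal.comp hg.continuous)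
  have h2 : ∀ x, conj (g x • G x) = conj (G x) * g x := fun x => by
    rw [Complex.real_smul, map_mul, Complex.conj_ofReal, mul_comm]
  simp only [← h2] at h1
  rw [integral_conj, map_eq_zero] at h1
  rw [← setIntegral_eq_integral_of_forall_compl_eq_zero (s := unitDisk), h1]
  intro x hx
  rw [image_eq_zero_of_notMem_tsupport fun h => hx (hgs h), zero_smul]

end

/-- Testing the weak gradient with `∂_y ψ` in the first component and with `∂_x ψ` in the second
gives the same left-hand side, by symmetry of second derivatives. -/
lemma HasWeakGradient.isCurlFree {u : ℂ → ℝ} {G : ℂ → ℂ} (h : HasWeakGradient u G)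
    (hu : Integrable u diskMeasure) (hG : Integrable G diskMeasure) : IsCurlFree G := by
  intro ψ hψ hc hs
  have hd : ContDiff ℝ ∞ (fderiv ℝ ψ) := hψ.fderiv_right (by simp)
  have hdv : ∀ v, ContDiff ℝ ∞ (fun x => fderiv ℝ ψ x v) := fun v => hd.clm_apply contDiff_const
  have hsv : ∀ v, tsupport (fun x => fderiv ℝ ψ x v) ⊆ tsupport ψ := fun v =>
    tsupport_fderiv_apply_subset ℝ v
  have hsnd : ∀ v w x, fderiv ℝ (fun y => fderiv ℝ ψ y v) x w = fderiv ℝ (fderiv ℝ ψ) x w v := by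
    intro v w x
    rw [fderiv_clm_apply (hd.differentiable (by simp) x) (by fun_prop)]
    simp
  have hsymm : ∀ v w x, fderiv ℝ (fun y => fderiv ℝ ψ y v) x w =
      fderiv ℝ (fun y => fderiv ℝ ψ y w) x v := fun v w x => by
    rw [hsnd, hsnd]
    exact hψ.contDiffAt.isSymmSndFDerivAt (by
      rw [minSmoothness_of_isRCLikeNormedField]
      exact WithTop.coe_le_coe.2 (le_top (a := (2 : ℕ∞)))) w v
  have hw : ∀ v, ∫ x in unitDisk, u x • ∇ (fun y => fderiv ℝ ψ y v) x =
      -∫ x in unitDisk, fderiv ℝ ψ x v • G x := fun v =>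
    h _ (hdv v) (hc.mono' (subset_closure.trans (hsv v))) ((hsv v).trans hs)
  have hi1 : ∀ v, Integrable (fun x => u x • ∇ (fun y => fderiv ℝ ψ y v) x) diskMeasure := by
    intro v
    obtain ⟨C, -, hC⟩ := exists_norm_le_of_continuous (continuous_gradient (hdv v))
    exact hu.smul_bdd C (continuous_gradient (hdv v)).aestronglyMeasurable
      (ae_mem_unitDisk.mono hC)
  have hi2 : ∀ v, Integrable (fun x => fderiv ℝ ψ x v • G x) diskMeasure := by
    intro v
    obtain ⟨C, -, hC⟩ := exists_norm_le_of_continuous (hdv v).continuous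
    exact hG.bdd_smul C (hdv v).continuous.aestronglyMeasurable (ae_mem_unitDisk.mono hC)
  have h1 := congrArg Complex.re (hw Complex.I)
  have h2 := congrArg Complex.im (hw 1)
  rw [Complex.neg_re, ← RCLike.re_to_complex, ← RCLike.re_to_complex, ← integral_re (hi1 _),
    ← integral_re (hi2 _)] at h1
  rw [Complex.neg_im, ← RCLike.im_to_complex, ← RCLike.im_to_complex, ← integral_im (hi1 _),
    ← integral_im (hi2 _)] at h2
  simp only [RCLike.re_to_complex, RCLike.im_to_complex, Complex.smul_re, Complex.smul_im,
    gradient_re, gradient_im, hsymm Complex.I 1] at h1 h2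
  have e : ∀ x, inner ℝ (Complex.I * G x) (∇ ψ x) =
      fderiv ℝ ψ x Complex.I • (G x).re - fderiv ℝ ψ x 1 • (G x).im := fun x => by
    rw [← conj_mul_im]
    simp [gradient_re, gradient_im]
    ring
  simp only [e]
  have hr : Integrable (fun x => fderiv ℝ ψ x Complex.I • (G x).re) diskMeasure := by
    simpa using (hi2 Complex.I).re
  have hm : Integrable (fun x => fderiv ℝ ψ x 1 • (G x).im) diskMeasure := by
    simpa using (hi2 1).im
  rw [integral_sub hr hm]
  linarith

/-! ### The Poincaré inequality in the disk -/

/-- The fundamental theorem of calculus on the segment from `y` to `x`, followed by Jensen's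
inequality for the square; the factor 4 bounds `|x - y|²`. -/
lemma enorm_segment_sq_le {φ : ℂ → ℝ} (hφ : ContDiff ℝ ∞ φ) (x y : ℂ) (hx : x ∈ unitDisk)
    (hy : y ∈ unitDisk) : ‖φ x - φ y‖ₑ ^ 2 ≤
      ∫⁻ t in Set.Icc (0 : ℝ) 1, 4 * ‖∇ φ ((1 - t : ℝ) * y + t * x)‖ₑ ^ 2 := by
  have : IsProbabilityMeasure (volume.restrict (Set.Icc (0 : ℝ) 1)) := ⟨by simp⟩
  set f : ℝ → ℝ := fun t => fderiv ℝ φ ((1 - t : ℝ) * y + t * x) (x - y) with hf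
  have hfc : Continuous f :=
    ((hφ.continuous_fderiv (by simp)).comp (by fun_prop)).clm_apply continuous_const
  have hgc : Continuous fun t : ℝ => ∇ φ ((1 - t : ℝ) * y + t * x) :=
    (continuous_gradient hφ).comp (by fun_prop)
  have hgi : IntegrableOn (fun t : ℝ => 4 * ‖∇ φ ((1 - t : ℝ) * y + t * x)‖ ^ 2) (Set.Icc 0 1) :=
    Continuous.integrableOn_Icc (by fun_prop)
  have hxy : ‖x - y‖ ≤ 2 := by
    have h1 := (mem_ball_zero_iff.1 hx).le
    have h2 := (mem_ball_zero_iff.1 hy).le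
    linarith [norm_sub_le x y]
  have h1 : ∫ t in Set.Icc (0 : ℝ) 1, f t = φ x - φ y := by
    rw [integral_Icc_eq_integral_Ioc, ← intervalIntegral.integral_of_le zero_le_one,
      intervalIntegral.integral_eq_sub_of_hasDerivAt
        (f := fun t : ℝ => φ ((1 - t : ℝ) * y + t * x)) _ (hfc.intervalIntegrable _ _)]
    · simp
    · intro t _
      have hd : HasDerivAt (fun t : ℝ => ((1 - t : ℝ) : ℂ) * y + t * x) (x - y) t := by
        have := ((((hasDerivAt_id t).const_sub 1).ofReal_comp).mul_const y).add
          ((hasDerivAt_id t).ofReal_comp.mul_const x)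
        refine HasDerivAt.congr_deriv (f := fun t : ℝ => ((1 - t : ℝ) : ℂ) * y + t * x) this ?_
        push_cast
        ring
      exact (hφ.differentiable (by simp) _).hasFDerivAt.comp_hasDerivAt t hd
  have h2 : (φ x - φ y) ^ 2 ≤ ∫ t in Set.Icc (0 : ℝ) 1, f t ^ 2 := by
    rw [← h1]
    exact (even_two.convexOn_pow (𝕜 := ℝ)).map_integral_le (by fun_prop) isClosed_univ (by simp)
      (hfc.continuousOn.integrableOn_compact isCompact_Icc)
      ((hfc.pow 2).continuousOn.integrableOn_compact isCompact_Icc)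
  have h3 : ∫ t in Set.Icc (0 : ℝ) 1, f t ^ 2 ≤
      ∫ t in Set.Icc (0 : ℝ) 1, 4 * ‖∇ φ ((1 - t : ℝ) * y + t * x)‖ ^ 2 := by
    refine integral_mono ((hfc.pow 2).continuousOn.integrableOn_compact isCompact_Icc) hgi
      fun t => ?_
    have h4 : |f t| ≤ ‖∇ φ ((1 - t : ℝ) * y + t * x)‖ * 2 := by
      rw [norm_gradient, ← Real.norm_eq_abs]
      exact (ContinuousLinearMap.le_opNorm _ _).trans (by gcongr)
    calc f t ^ 2 = |f t| ^ 2 := (sq_abs _).symm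
      _ ≤ (‖∇ φ ((1 - t : ℝ) * y + t * x)‖ * 2) ^ 2 := by gcongr
      _ = _ := by ring
  have h4 : ‖φ x - φ y‖ₑ ^ 2 = ENNReal.ofReal ((φ x - φ y) ^ 2) := by
    rw [← sq_abs, ENNReal.ofReal_pow (abs_nonneg _), ← Real.enorm_eq_ofReal_abs]
  rw [h4]
  refine (ENNReal.ofReal_le_ofReal (h2.trans h3)).trans ?_
  rw [ofReal_integral_eq_lintegral_ofReal hgi
    (Filter.Eventually.of_forall fun t => by positivity)]
  refine lintegral_mono fun t => ?_
  rw [ENNReal.ofReal_mul (by norm_num), ENNReal.ofReal_pow (norm_nonneg _), ofReal_norm]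
  simp

/-- By convexity the contraction towards `y` maps the disk into itself, and its Jacobian `t²` is at
least `1 / 4`. -/
lemma lintegral_unitDisk_affine_le {g : ℂ → ENNReal} (hg : Measurable g) {t : ℝ} (h0 : 1 / 2 ≤ t)
    (h1 : t ≤ 1) {y : ℂ} (hy : y ∈ unitDisk) :
    ∫⁻ x in unitDisk, g ((1 - t : ℝ) * y + t * x) ≤ 4 * ∫⁻ x in unitDisk, g x := by
  set c : ℂ := (1 - t : ℝ) * y
  have ht : t ≠ 0 := by linarith
  have hgi : Measurable (unitDisk.indicator g) := hg.indicator measurableSet_ball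
  calc ∫⁻ x in unitDisk, g (c + t * x)
      ≤ ∫⁻ x in unitDisk, unitDisk.indicator g (c + t • x) := by
        refine setLIntegral_mono' measurableSet_ball fun x hx => ?_
        have : c + t • x ∈ unitDisk := by
          have := (convex_ball (0 : ℂ) 1) hy hx (a := 1 - t) (b := t) (by linarith) (by linarith)
            (by ring)
          simpa [c, Complex.real_smul] using this
        rw [Set.indicator_of_mem this, Complex.real_smul]
    _ ≤ ∫⁻ x, unitDisk.indicator g (c + t • x) := setLIntegral_le_lintegral _ _
    _ = ∫⁻ z, unitDisk.indicator g (c + z) ∂(Measure.map (fun x : ℂ => t • x) volume) := by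
        rw [lintegral_map (f := fun z => unitDisk.indicator g (c + z))
          (hgi.comp (measurable_const_add c)) (measurable_const_smul t)]
    _ = ENNReal.ofReal |(t ^ 2)⁻¹| * ∫⁻ z, unitDisk.indicator g z := by
        rw [Measure.map_addHaar_smul _ ht, lintegral_smul_measure, lintegral_add_left_eq_self,
          Complex.finrank_real_complex, smul_eq_mul]
    _ ≤ 4 * ∫⁻ x in unitDisk, g x := by
        rw [lintegral_indicator measurableSet_ball]
        gcongr
        rw [← ENNReal.ofReal_ofNat 4]
        refine ENNReal.ofReal_le_ofReal ?_
        rw [abs_of_nonneg (by positivity), inv_le_comm₀ (by positivity) (by norm_num)]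
        nlinarith

lemma lintegral_unitDisk_segment_le {g : ℂ → ENNReal} (hg : Measurable g) {t : ℝ}
    (ht : t ∈ Set.Icc (0 : ℝ) 1) :
    ∫⁻ y in unitDisk, ∫⁻ x in unitDisk, g ((1 - t : ℝ) * y + t * x) ≤
      4 * volume unitDisk * ∫⁻ x in unitDisk, g x := by
  have key : ∀ t ∈ Set.Icc (1 / 2 : ℝ) 1,
      ∫⁻ y in unitDisk, ∫⁻ x in unitDisk, g ((1 - t : ℝ) * y + t * x) ≤
        4 * volume unitDisk * ∫⁻ x in unitDisk, g x := by
    intro t ht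
    calc _ ≤ ∫⁻ _ in unitDisk, 4 * ∫⁻ x in unitDisk, g x :=
          setLIntegral_mono' measurableSet_ball fun y hy =>
            lintegral_unitDisk_affine_le hg ht.1 ht.2 hy
      _ = _ := by rw [setLIntegral_const]; ring
  rcases le_total (1 / 2) t with h | h
  · exact key t ⟨h, ht.2⟩
  -- For `t ≤ 1 / 2` the contraction in `x` degenerates; exchanging `x` and `y` replaces `t` by `1 -
  -- t`.
  · rw [lintegral_lintegral_swap]
    · have := key (1 - t) ⟨by linarith, by linarith [ht.1]⟩
      simpa [add_comm] using this
    · exact (hg.comp (by fun_prop)).aemeasurable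

/-- The Poincaré inequality in the disk, in symmetric form. -/
lemma lintegral_lintegral_sub_sq_le {φ : ℂ → ℝ} (hφ : ContDiff ℝ ∞ φ) :
    ∫⁻ y in unitDisk, ∫⁻ x in unitDisk, ‖φ x - φ y‖ₑ ^ 2 ≤
      16 * volume unitDisk * ∫⁻ x in unitDisk, ‖∇ φ x‖ₑ ^ 2 := by
  have hg : Measurable fun x => 4 * ‖∇ φ x‖ₑ ^ 2 := by
    have := (continuous_gradient hφ).measurable
    fun_prop
  have hgc := (continuous_gradient hφ).measurable
  calc ∫⁻ y in unitDisk, ∫⁻ x in unitDisk, ‖φ x - φ y‖ₑ ^ 2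
      ≤ ∫⁻ y in unitDisk, ∫⁻ x in unitDisk, ∫⁻ t in Set.Icc (0 : ℝ) 1,
          4 * ‖∇ φ ((1 - t : ℝ) * y + t * x)‖ₑ ^ 2 :=
        setLIntegral_mono' measurableSet_ball fun y hy =>
          setLIntegral_mono' measurableSet_ball fun x hx => enorm_segment_sq_le hφ x y hx hy
    _ = ∫⁻ y in unitDisk, ∫⁻ t in Set.Icc (0 : ℝ) 1, ∫⁻ x in unitDisk,
          4 * ‖∇ φ ((1 - t : ℝ) * y + t * x)‖ₑ ^ 2 := by
        refine lintegral_congr fun y => lintegral_lintegral_swap ?_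
        unfold Function.uncurry
        refine Measurable.aemeasurable ?_
        exact hg.comp (g := fun x => 4 * ‖∇ φ x‖ₑ ^ 2) (by fun_prop)
    _ = ∫⁻ t in Set.Icc (0 : ℝ) 1, ∫⁻ y in unitDisk, ∫⁻ x in unitDisk,
          4 * ‖∇ φ ((1 - t : ℝ) * y + t * x)‖ₑ ^ 2 := by
        refine lintegral_lintegral_swap (Measurable.aemeasurable ?_)
        refine Measurable.lintegral_prod_right' (f := fun p : (ℂ × ℝ) × ℂ =>
          (4 : ENNReal) * ‖∇ φ ((1 - p.1.2 : ℝ) * p.1.1 + p.1.2 * p.2)‖ₑ ^ 2) ?_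
        exact hg.comp (g := fun x => 4 * ‖∇ φ x‖ₑ ^ 2) (by fun_prop)
    _ ≤ ∫⁻ t in Set.Icc (0 : ℝ) 1, 4 * volume unitDisk * ∫⁻ x in unitDisk, 4 * ‖∇ φ x‖ₑ ^ 2 :=
        setLIntegral_mono' measurableSet_Icc fun t ht => lintegral_unitDisk_segment_le hg ht
    _ = _ := by
        rw [setLIntegral_const, Real.volume_Icc, lintegral_const_mul _ (by fun_prop)]
        simp
        ring

/-- The Poincaré inequality in the disk for functions of mean zero. -/
lemma eLpNorm_le_eLpNorm_gradient {φ : ℂ → ℝ} (hφ : ContDiff ℝ ∞ φ)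
    (h0 : ∫ x in unitDisk, φ x = 0) :
    eLpNorm φ 2 diskMeasure ≤ 4 * eLpNorm (∇ φ) 2 diskMeasure := by
  have hsq : ∀ r : ℝ, ‖r‖ₑ ^ 2 = ENNReal.ofReal (r ^ 2) := fun r => by
    rw [← sq_abs, ENNReal.ofReal_pow (abs_nonneg _), ← Real.enorm_eq_ofReal_abs]
  have hint : ∀ {f : ℂ → ℝ}, Continuous f → Integrable f diskMeasure := fun hf =>
    memLp_one_iff_integrable.1 (memLp_of_continuous hf 1)
  have hc := hφ.continuous
  have hv0 : volume unitDisk ≠ 0 := (Metric.measure_ball_pos volume (0 : ℂ) one_pos).ne'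
  have hvt : volume unitDisk ≠ ⊤ := measure_ball_lt_top.ne
  -- For mean zero the cross term drops out, so subtracting the constant `φ y` can only increase the
  -- square integral. Integration over `y` then yields the constant `4 = √16`.
  have h1 : ∀ y, ∫⁻ x in unitDisk, ‖φ x‖ₑ ^ 2 ≤ ∫⁻ x in unitDisk, ‖φ x - φ y‖ₑ ^ 2 := by
    intro y
    simp only [hsq]
    rw [← ofReal_integral_eq_lintegral_ofReal (hint (by fun_prop))
        (Filter.Eventually.of_forall fun _ => sq_nonneg _),
      ← ofReal_integral_eq_lintegral_ofReal (hint (by fun_prop))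
        (Filter.Eventually.of_forall fun _ => sq_nonneg _)]
    refine ENNReal.ofReal_le_ofReal ?_
    have e : ∀ x, (φ x - φ y) ^ 2 = φ x ^ 2 - 2 * φ y * φ x + φ y ^ 2 := fun x => by ring
    simp only [e]
    rw [integral_add (hint (by fun_prop)) (hint (by fun_prop)),
      integral_sub (hint (by fun_prop)) (hint (by fun_prop)), integral_const_mul, h0]
    have : 0 ≤ ∫ _ in unitDisk, φ y ^ 2 := integral_nonneg fun _ => sq_nonneg _
    linarith
  have h2 : volume unitDisk * ∫⁻ x in unitDisk, ‖φ x‖ₑ ^ 2 ≤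
      volume unitDisk * (16 * ∫⁻ x in unitDisk, ‖∇ φ x‖ₑ ^ 2) := by
    calc _ = ∫⁻ _ in unitDisk, ∫⁻ x in unitDisk, ‖φ x‖ₑ ^ 2 := by
          rw [setLIntegral_const, mul_comm]
      _ ≤ _ := lintegral_mono h1
      _ ≤ _ := lintegral_lintegral_sub_sq_le hφ
      _ = _ := by ring
  have h3 := (ENNReal.mul_le_mul_iff_right hv0 hvt).1 h2
  have hsqrt : ∀ {E : Type} [NormedAddCommGroup E] (f : ℂ → E), eLpNorm f 2 diskMeasure =
      (∫⁻ x in unitDisk, ‖f x‖ₑ ^ 2) ^ (1 / 2 : ℝ) := fun f => by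
    rw [eLpNorm_eq_lintegral_rpow_enorm_toReal (by simp) (by simp)]
    simp
  rw [hsqrt, hsqrt]
  calc _ ≤ (16 * ∫⁻ x in unitDisk, ‖∇ φ x‖ₑ ^ 2) ^ (1 / 2 : ℝ) := by gcongr
    _ = _ := by
      rw [ENNReal.mul_rpow_of_nonneg _ _ (by norm_num)]
      congr 1
      rw [show (16 : ENNReal) = 4 ^ (2 : ℝ) by norm_num, ← ENNReal.rpow_mul]
      norm_num

/-! ### The Hilbert space of gradients -/

/-- The Hilbert space of square integrable vector fields on the disk. -/
abbrev FieldSpace : Type := Lp ℂ 2 diskMeasure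

lemma memLp_gradient {φ : ℂ → ℝ} (hφ : ContDiff ℝ ∞ φ) : MemLp (∇ φ) 2 diskMeasure :=
  memLp_of_continuous (continuous_gradient hφ) 2

/-- The gradients of smooth functions. -/
noncomputable def smoothGradients : Submodule ℝ FieldSpace where
  carrier := {f | ∃ φ : ℂ → ℝ, ContDiff ℝ ∞ φ ∧ f =ᵐ[diskMeasure] ∇ φ}
  zero_mem' := ⟨fun _ => 0, contDiff_const, by
    filter_upwards [Lp.coeFn_zero ℂ 2 diskMeasure] with x hx
    rw [gradient_fun_const']
    exact hx⟩
  add_mem' := by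
    rintro f g ⟨φ, hφ, hf⟩ ⟨ψ, hψ, hg⟩
    refine ⟨fun x => φ x + ψ x, hφ.add hψ, ?_⟩
    filter_upwards [Lp.coeFn_add f g, hf, hg] with x h1 h2 h3
    rw [h1, Pi.add_apply, h2, h3]
    simp only [gradient]
    rw [fderiv_fun_add (hφ.differentiable (by simp) x)
      (hψ.differentiable (by simp) x), map_add]
  smul_mem' := by
    rintro c f ⟨φ, hφ, hf⟩
    refine ⟨fun x => c • φ x, hφ.const_smul c, ?_⟩
    filter_upwards [Lp.coeFn_smul c f, hf] with x h1 h2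
    rw [h1, Pi.smul_apply, h2]
    simp only [gradient]
    rw [fderiv_fun_const_smul (hφ.differentiable (by simp) x), map_smul]

/-- The closure of the gradients of smooth functions in `L²`. -/
noncomputable def gradientSpace : Submodule ℝ FieldSpace := smoothGradients.topologicalClosure

lemma toLp_gradient_mem {φ : ℂ → ℝ} (hφ : ContDiff ℝ ∞ φ) :
    (memLp_gradient hφ).toLp (∇ φ) ∈ gradientSpace :=
  smoothGradients.le_topologicalClosure ⟨φ, hφ, MemLp.coeFn_toLp _⟩

lemma integrable_of_memLp_two {E : Type*} [NormedAddCommGroup E] {f : ℂ → E}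
    (h : MemLp f 2 diskMeasure) : Integrable f diskMeasure :=
  h.integrable (by norm_num)

lemma HasWeakGradient.of_tendsto {u : ℂ → ℝ} {G : ℂ → ℂ} {U : ℕ → ℂ → ℝ} {V : ℕ → ℂ → ℂ}
    (h : ∀ n, HasWeakGradient (U n) (V n)) (hu : MemLp u 2 diskMeasure)
    (hG : MemLp G 2 diskMeasure)
    (hU : ∀ n, MemLp (U n) 2 diskMeasure) (hV : ∀ n, MemLp (V n) 2 diskMeasure)
    (hUu : Filter.Tendsto (fun n => eLpNorm (U n - u) 2 diskMeasure) Filter.atTop (nhds 0))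
    (hVG : Filter.Tendsto (fun n => eLpNorm (V n - G) 2 diskMeasure) Filter.atTop (nhds 0)) :
    HasWeakGradient u G := by
  intro φ hφ hc hs
  have hgc := continuous_gradient hφ
  obtain ⟨A, -, hA⟩ := exists_norm_le_of_continuous hφ.continuous
  obtain ⟨B, -, hB⟩ := exists_norm_le_of_continuous hgc
  have hm1 : ∀ {u : ℂ → ℝ}, MemLp u 2 diskMeasure → MemLp (fun x => u x • ∇ φ x) 1 diskMeasure :=
    fun hu => memLp_one_iff_integrable.2 ((integrable_of_memLp_two hu).smul_bdd B
      hgc.aestronglyMeasurable (ae_mem_unitDisk.mono hB))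
  have hm2 : ∀ {G : ℂ → ℂ}, MemLp G 2 diskMeasure → MemLp (fun x => φ x • G x) 1 diskMeasure :=
    fun hG => memLp_one_iff_integrable.2 ((integrable_of_memLp_two hG).bdd_smul A
      hφ.continuous.aestronglyMeasurable (ae_mem_unitDisk.mono hA))
  have ht1 : Filter.Tendsto (fun n => ∫ x in unitDisk, U n x • ∇ φ x) Filter.atTop
      (nhds (∫ x in unitDisk, u x • ∇ φ x)) := by
    refine tendsto_integral_of_L1' _ (hm1 hu).aestronglyMeasurable
      (Filter.Eventually.of_forall fun n => memLp_one_iff_integrable.1 (hm1 (hU n))) ?_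
    have hgB : MemLp (∇ φ) 2 diskMeasure := memLp_gradient hφ
    have hle : ∀ n, eLpNorm ((fun x => U n x • ∇ φ x) - fun x => u x • ∇ φ x) 1 diskMeasure ≤
        eLpNorm (U n - u) 2 diskMeasure * eLpNorm (∇ φ) 2 diskMeasure := fun n => by
      have : ((fun x => U n x • ∇ φ x) - fun x => u x • ∇ φ x) = (U n - u) • ∇ φ := by
        funext x; simp [sub_smul]
      rw [this]
      exact eLpNorm_smul_le_mul_eLpNorm hgB.aestronglyMeasurable
        ((hU n).sub hu).aestronglyMeasurable
    refine tendsto_of_tendsto_of_tendsto_of_le_of_le tendsto_const_nhds ?_ (fun _ => zero_le) hle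
    simpa using ENNReal.Tendsto.mul_const hUu (Or.inr hgB.eLpNorm_ne_top)
  have ht2 : Filter.Tendsto (fun n => -∫ x in unitDisk, φ x • V n x) Filter.atTop
      (nhds (-∫ x in unitDisk, φ x • G x)) := by
    refine (tendsto_integral_of_L1' _ (hm2 hG).aestronglyMeasurable
      (Filter.Eventually.of_forall fun n => memLp_one_iff_integrable.1 (hm2 (hV n))) ?_).neg
    have hgB : MemLp φ 2 diskMeasure := memLp_of_continuous hφ.continuous 2
    have hle : ∀ n, eLpNorm ((fun x => φ x • V n x) - fun x => φ x • G x) 1 diskMeasure ≤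
        eLpNorm φ 2 diskMeasure * eLpNorm (V n - G) 2 diskMeasure := fun n => by
      have : ((fun x => φ x • V n x) - fun x => φ x • G x) = φ • (V n - G) := by
        funext x; simp [mul_sub]
      rw [this]
      exact eLpNorm_smul_le_mul_eLpNorm ((hV n).sub hG).aestronglyMeasurable
        hgB.aestronglyMeasurable
    refine tendsto_of_tendsto_of_tendsto_of_le_of_le tendsto_const_nhds ?_ (fun _ => zero_le) hle
    simpa using ENNReal.Tendsto.const_mul hVG (Or.inr hgB.eLpNorm_ne_top)
  simp only [fun n => h n φ hφ hc hs] at ht1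
  exact tendsto_nhds_unique ht1 ht2

/-- The elements of `gradientSpace` are weak gradients. -/
lemma exists_primitive {f : FieldSpace} (hf : f ∈ gradientSpace) : ∃ u, MemSobolev 2 u f := by
  obtain ⟨F, hF, hlim⟩ := mem_closure_iff_seq_limit.1 (show f ∈ closure (smoothGradients :
    Set FieldSpace) from hf)
  choose φ hφ hFφ using hF
  -- Subtracting means makes the Poincaré inequality applicable, so convergence of the gradients
  -- forces the normalised potentials to be Cauchy.
  set m : ℕ → ℝ := fun n => (volume.real unitDisk)⁻¹ * ∫ x in unitDisk, φ n x
  set ψ : ℕ → ℂ → ℝ := fun n x => φ n x - m n with hψdef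
  have hv0 : volume.real unitDisk ≠ 0 := by
    rw [Measure.real, ENNReal.toReal_ne_zero]
    exact ⟨(Metric.measure_ball_pos volume (0 : ℂ) one_pos).ne', measure_ball_lt_top.ne⟩
  have hψ : ∀ n, ContDiff ℝ ∞ (ψ n) := fun n => (hφ n).sub contDiff_const
  have hint : ∀ {f : ℂ → ℝ}, Continuous f → Integrable f diskMeasure := fun hf =>
    memLp_one_iff_integrable.1 (memLp_of_continuous hf 1)
  have hψ0 : ∀ n, ∫ x in unitDisk, ψ n x = 0 := fun n => by
    simp only [hψdef]
    rw [integral_sub (hint (hφ n).continuous) (hint continuous_const), setIntegral_const,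
      smul_eq_mul, mul_inv_cancel_left₀ hv0, sub_self]
  have hFψ : ∀ n, F n =ᵐ[diskMeasure] ∇ (ψ n) := fun n => by
    filter_upwards [hFφ n] with x hx
    rw [hx]
    simp only [gradient, hψdef, fderiv_sub_const]
  have hm : ∀ n, MemLp (ψ n) 2 diskMeasure := fun n => memLp_of_continuous (hψ n).continuous 2
  have hdist : ∀ k n, edist ((hm k).toLp (ψ k)) ((hm n).toLp (ψ n)) ≤ 4 * edist (F k) (F n) := by
    intro k n
    rw [Lp.edist_toLp_toLp, Lp.edist_def]
    have h1 : ∫ x in unitDisk, (ψ k x - ψ n x) = 0 := by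
      rw [integral_sub (hint (hψ k).continuous) (hint (hψ n).continuous), hψ0, hψ0, sub_zero]
    refine (eLpNorm_le_eLpNorm_gradient ((hψ k).sub (hψ n)) h1).trans (le_of_eq ?_)
    congr 1
    refine eLpNorm_congr_ae ?_
    filter_upwards [hFψ k, hFψ n] with x h2 h3
    rw [Pi.sub_apply, h2, h3, gradient, fderiv_fun_sub ((hψ k).differentiable (by simp) x)
      ((hψ n).differentiable (by simp) x), map_sub]
    rfl
  have hcauchy : CauchySeq fun n => (hm n).toLp (ψ n) := by
    have hFc := EMetric.cauchySeq_iff.1 hlim.cauchySeq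
    refine EMetric.cauchySeq_iff.2 fun ε hε => ?_
    obtain ⟨N, hN⟩ := hFc (ε / 4) (ENNReal.div_pos hε.ne' (by simp))
    refine ⟨N, fun k hk n hn => (hdist k n).trans_lt ?_⟩
    rw [mul_comm]
    exact ENNReal.mul_lt_of_lt_div (hN k hk n hn)
  obtain ⟨u, hu⟩ := cauchySeq_tendsto_of_complete hcauchy
  refine ⟨u, Lp.memLp u, Lp.memLp f, ?_⟩
  refine HasWeakGradient.of_tendsto (U := ψ) (V := fun n => ∇ (ψ n))
    (fun n => hasWeakGradient_of_contDiffOn ((hψ n).of_le (by simp)).contDiffOn) (Lp.memLp u)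
    (Lp.memLp f) hm (fun n => memLp_gradient (hψ n)) ?_ ?_
  · refine (tendsto_iff_edist_tendsto_0.1 hu).congr fun n => ?_
    rw [Lp.edist_def]
    refine eLpNorm_congr_ae ?_
    filter_upwards [(hm n).coeFn_toLp] with x hx
    simp [hx]
  · refine (tendsto_iff_edist_tendsto_0.1 hlim).congr fun n => ?_
    rw [Lp.edist_def]
    refine eLpNorm_congr_ae ?_
    filter_upwards [hFψ n] with x hx
    simp [hx]

lemma isCurlFree_of_mem_gradientSpace {f : FieldSpace} (hf : f ∈ gradientSpace) :
    IsCurlFree f := by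
  obtain ⟨u, hu⟩ := exists_primitive hf
  exact hu.hasWeakGradient.isCurlFree (integrable_of_memLp_two hu.memLp)
    (integrable_of_memLp_two hu.memLp_grad)

lemma IsCurlFree.sub {G H : ℂ → ℂ} (hG : IsCurlFree G) (hH : IsCurlFree H)
    (hGi : Integrable G diskMeasure) (hHi : Integrable H diskMeasure) :
    IsCurlFree fun x => G x - H x := by
  intro ψ hψ hc hs
  simp only [mul_sub, inner_sub_left]
  rw [integral_sub (integrable_inner_of_continuous (hGi.const_mul _) (continuous_gradient hψ))
    (integrable_inner_of_continuous (hHi.const_mul _) (continuous_gradient hψ)), hG ψ hψ hc hs,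
    hH ψ hψ hc hs, sub_zero]

lemma IsCurlFree.congr_ae {G H : ℂ → ℂ} (hG : IsCurlFree G) (h : G =ᵐ[diskMeasure] H) :
    IsCurlFree H := by
  intro ψ hψ hc hs
  rw [← hG ψ hψ hc hs]
  refine integral_congr_ae ?_
  filter_upwards [h] with x hx
  rw [hx]

instance : CompleteSpace gradientSpace :=
  smoothGradients.isClosed_topologicalClosure.completeSpace_coe

/-- Curl-free square integrable fields are limits of gradients of smooth functions. -/
lemma mem_gradientSpace_of_isCurlFree {f : FieldSpace} (hf : IsCurlFree f) :
    f ∈ gradientSpace := by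
  set p : FieldSpace := gradientSpace.starProjection f with hp
  have hpm : p ∈ gradientSpace := Submodule.starProjection_apply_mem _ _
  have hpo : ∀ g ∈ gradientSpace, inner ℝ (f - p) g = 0 := fun g hg =>
    Submodule.starProjection_inner_eq_zero f g hg
  have hi : ∀ f : FieldSpace, Integrable f diskMeasure := fun f =>
    integrable_of_memLp_two (Lp.memLp f)
  -- Orthogonality to smooth gradients is the zero Neumann condition, and `f - p` is curl-free, so
  -- the uniqueness theorem applies.
  have h0 : ∀ᵐ x ∂diskMeasure, (f - p : FieldSpace) x = 0 := by
    refine ae_eq_zero_of_isCurlFree (hi _) ?_ fun φ hφ => ?_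
    · refine (hf.sub (isCurlFree_of_mem_gradientSpace hpm) (hi f) (hi p)).congr_ae ?_
      filter_upwards [Lp.coeFn_sub f p] with x hx
      rw [hx, Pi.sub_apply]
    · rw [← hpo _ (toLp_gradient_mem hφ), L2.inner_def]
      refine integral_congr_ae ?_
      filter_upwards [(memLp_gradient hφ).coeFn_toLp] with x hx
      rw [hx]
  have : f - p = 0 := Lp.eq_zero_iff_ae_eq_zero.2 h0
  rw [sub_eq_zero.1 this]
  exact hpm

/-! ### Lax-Milgram and the potentials of point sources -/

lemma exists_mulOperator {m : ℂ → ℝ} (hm : AEStronglyMeasurable m diskMeasure) {C : ℝ}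
    (hC : ∀ᵐ x ∂diskMeasure, |m x| ≤ C) :
    ∃ T : FieldSpace →L[ℝ] FieldSpace, ∀ f, T f =ᵐ[diskMeasure] fun x => m x • f x := by
  have hmL : MemLp m ⊤ diskMeasure := memLp_top_of_bound hm C hC
  refine ⟨(ContinuousLinearMap.lsmul ℝ ℝ : ℝ →L[ℝ] ℂ →L[ℝ] ℂ).holderL diskMeasure ⊤ 2 2
    (hmL.toLp m), fun f => ?_⟩
  refine ((ContinuousLinearMap.lsmul ℝ ℝ : ℝ →L[ℝ] ℂ →L[ℝ] ℂ).coeFn_holder _ f).trans ?_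
  filter_upwards [hmL.coeFn_toLp] with x hx
  rw [hx]
  rfl

lemma inner_eq_integral_of_ae_eq {f g : FieldSpace} {F G : ℂ → ℂ} (hf : f =ᵐ[diskMeasure] F)
    (hg : g =ᵐ[diskMeasure] G) : inner ℝ f g = ∫ x in unitDisk, inner ℝ (F x) (G x) := by
  rw [L2.inner_def]
  refine integral_congr_ae ?_
  filter_upwards [hf, hg] with x h1 h2
  rw [h1, h2]

/-- Solvability of the variational problem in `gradientSpace`, by the Lax-Milgram theorem. -/
lemma exists_solutionOperator {S : FieldSpace →L[ℝ] FieldSpace} {c : ℝ} (hc : 0 < c)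
    (hS : ∀ f, c * ‖f‖ ^ 2 ≤ inner ℝ (S f) f) :
    ∃ A : FieldSpace →L[ℝ] FieldSpace, (∀ f, A f ∈ gradientSpace) ∧
      (∀ f, ∀ g ∈ gradientSpace, inner ℝ (S (A f)) g = inner ℝ f g) ∧
      ∀ f, ∀ D ∈ gradientSpace, (∀ g ∈ smoothGradients, inner ℝ (S D) g = inner ℝ f g) →
        D = A f := by
  let B : gradientSpace →L[ℝ] gradientSpace →L[ℝ] ℝ :=
    LinearMap.mkContinuous₂ (LinearMap.mk₂ ℝ
      (fun v w : gradientSpace => inner ℝ (S (v : FieldSpace)) (w : FieldSpace))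
      (fun v v' w => by simp [inner_add_left]) (fun a v w => by simp [real_inner_smul_left])
      (fun v w w' => by simp [inner_add_right]) (fun a v w => by simp [real_inner_smul_right]))
      ‖S‖ (fun v w => (norm_inner_le_norm (S (v : FieldSpace)) (w : FieldSpace)).trans
        (mul_le_mul_of_nonneg_right (S.le_opNorm _) (norm_nonneg _)))
  have hB : ∀ v w, B v w = inner ℝ (S (v : FieldSpace)) (w : FieldSpace) := fun v w => rfl
  have hBc : IsCoercive B := ⟨c, hc, fun v => by
    rw [hB, mul_assoc, ← sq]; exact hS v⟩
  let e := hBc.continuousLinearEquivOfBilin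
  let A : FieldSpace →L[ℝ] FieldSpace :=
    gradientSpace.subtypeL ∘L (e.symm : gradientSpace →L[ℝ] gradientSpace) ∘L
      gradientSpace.orthogonalProjectionOnto
  have hA : ∀ f, A f ∈ gradientSpace := fun f => (e.symm (gradientSpace.orthogonalProjectionOnto f)).2
  have hAeq : ∀ f, ∀ g ∈ gradientSpace, inner ℝ (S (A f)) g = inner ℝ f g := by
    intro f g hg
    have h1 := hBc.continuousLinearEquivOfBilin_apply
      (e.symm (gradientSpace.orthogonalProjectionOnto f)) ⟨g, hg⟩
    have h2 : hBc.continuousLinearEquivOfBilin (e.symm (gradientSpace.orthogonalProjectionOnto f)) =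
      gradientSpace.orthogonalProjectionOnto f := e.apply_symm_apply _
    rw [h2, hB] at h1
    rw [← Submodule.inner_orthogonalProjectionOnto_eq_of_mem_right ⟨g, hg⟩ f]
    exact h1.symm
  refine ⟨A, hA, hAeq, fun f D hD h => ?_⟩
  -- Both sides are continuous in `g`, so testing with smooth gradients suffices; coercivity at `D -
  -- A f` then gives uniqueness.
  have h1 : ∀ g ∈ gradientSpace, inner ℝ (S D) g = inner ℝ f g := by
    have hcl : IsClosed {g : FieldSpace | inner ℝ (S D) g = inner ℝ f g} :=
      isClosed_eq (by fun_prop) (by fun_prop)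
    intro g hg
    exact closure_minimal (s := (smoothGradients : Set FieldSpace)) h hcl hg
  have h2 : D - A f ∈ gradientSpace := gradientSpace.sub_mem hD (hA f)
  have h3 := hS (D - A f)
  rw [map_sub, inner_sub_left, h1 _ h2, hAeq _ _ h2, sub_self] at h3
  have h4 : ‖D - A f‖ ^ 2 ≤ 0 := by
    by_contra h
    nlinarith
  have h5 : ‖D - A f‖ = 0 := by nlinarith [sq_nonneg ‖D - A f‖]
  exact sub_eq_zero.1 (norm_eq_zero.1 h5)

lemma HasWeakGradient.add {u v : ℂ → ℝ} {G H : ℂ → ℂ} (hu : HasWeakGradient u G)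
    (hv : HasWeakGradient v H) (hui : Integrable u diskMeasure) (hvi : Integrable v diskMeasure)
    (hG : Integrable G diskMeasure) (hH : Integrable H diskMeasure) :
    HasWeakGradient (u + v) (G + H) := by
  intro φ hφ hc hs
  obtain ⟨A, -, hA⟩ := exists_norm_le_of_continuous hφ.continuous
  obtain ⟨B, -, hB⟩ := exists_norm_le_of_continuous (continuous_gradient hφ)
  have h1 : ∀ {u : ℂ → ℝ}, Integrable u diskMeasure →
      Integrable (fun x => u x • ∇ φ x) diskMeasure := fun hu =>
    hu.smul_bdd B (continuous_gradient hφ).aestronglyMeasurable (ae_mem_unitDisk.mono hB)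
  have h2 : ∀ {G : ℂ → ℂ}, Integrable G diskMeasure →
      Integrable (fun x => φ x • G x) diskMeasure := fun hG =>
    hG.bdd_smul A hφ.continuous.aestronglyMeasurable (ae_mem_unitDisk.mono hA)
  simp only [Pi.add_apply, add_smul, smul_add]
  rw [integral_add (h1 hui) (h1 hvi), integral_add (h2 hG) (h2 hH), hu φ hφ hc hs, hv φ hφ hc hs,
    neg_add]

lemma MemSobolev.isCurlFree {p : ENNReal} (hp : 1 ≤ p) {u : ℂ → ℝ} {G : ℂ → ℂ}
    (h : MemSobolev p u G) : IsCurlFree G :=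
  h.hasWeakGradient.isCurlFree (h.memLp.integrable hp) (h.memLp_grad.integrable hp)

/-- The gradient of the background potential is unique. -/
lemma IsBackgroundPotential.ae_eq {μ : MeanFreeMeasure} {u v : ℂ → ℝ} {G H : ℂ → ℂ}
    (hu : IsBackgroundPotential μ u G) (hv : IsBackgroundPotential μ v H) :
    G =ᵐ[diskMeasure] H := by
  have hG := memLp_one_iff_integrable.1 hu.memSobolev.memLp_grad
  have hH := memLp_one_iff_integrable.1 hv.memSobolev.memLp_grad
  have h := ae_eq_zero_of_isCurlFree (hG.sub hH)
    ((hu.memSobolev.isCurlFree le_rfl).sub (hv.memSobolev.isCurlFree le_rfl) hG hH)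
    (fun φ hφ => by
      have h1 := hu.weak_eq φ hφ
      have h2 := hv.weak_eq φ hφ
      simp only [one_mul] at h1 h2
      simp only [Pi.sub_apply, inner_sub_left]
      rw [integral_sub (integrable_inner_of_continuous hG (continuous_gradient hφ))
        (integrable_inner_of_continuous hH (continuous_gradient hφ)), h1, h2, sub_self])
  filter_upwards [h] with x hx
  exact sub_eq_zero.1 hx

/-- The gradient of the potential of a point source differs from the background field by a bounded
operator applied to the cut-off of the background field to a smaller concentric disk. -/
lemma exists_potentialOperator {σ : ℂ → ℝ} (hσ : IsFeasibleConductivity σ) :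
    ∃ ρ : ℝ, 0 < ρ ∧ ρ < 1 ∧ (∀ᵐ x ∂diskMeasure, x ∉ Metric.closedBall (0 : ℂ) ρ → σ x = 1) ∧
    ∃ M T : FieldSpace →L[ℝ] FieldSpace, (∀ f, M f =ᵐ[diskMeasure] fun x => (1 - σ x) • f x) ∧
      ∀ θ η : ℝ, ∀ Φ : FieldSpace, (Φ =ᵐ[diskMeasure] (Metric.closedBall (0 : ℂ) ρ).indicator
        (dipoleField (boundaryPoint θ) (boundaryPoint η))) →
        (∃ u G, IsPotential σ (dipole θ η) u G) ∧ ∀ u G, IsPotential σ (dipole θ η) u G →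
          G =ᵐ[diskMeasure] fun x =>
            dipoleField (boundaryPoint θ) (boundaryPoint η) x + T Φ x := by
  obtain ⟨c, C, hc, hb⟩ := hσ.bounds
  obtain ⟨K, hK, hKB, hσK⟩ := hσ.homogeneous
  obtain ⟨ρ, hρ, hKρ⟩ := exists_pos_lt_subset_ball one_pos hK.isClosed hKB
  have hσρ : ∀ᵐ x ∂diskMeasure, x ∉ Metric.closedBall (0 : ℂ) ρ → σ x = 1 := by
    filter_upwards [hσK] with x hx h
    exact hx fun hxK => h (Metric.ball_subset_closedBall (hKρ hxK))
  have hσC : ∀ᵐ x ∂diskMeasure, |σ x| ≤ C := by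
    filter_upwards [hb] with x hx
    rw [abs_of_pos (hc.trans_le hx.1)]; exact hx.2
  have hmC : ∀ᵐ x ∂diskMeasure, |1 - σ x| ≤ 1 + C := by
    filter_upwards [hσC] with x hx
    exact (abs_sub _ _).trans (by rw [abs_one]; linarith)
  obtain ⟨S, hS⟩ := exists_mulOperator hσ.aestronglyMeasurable hσC
  obtain ⟨M, hM⟩ := exists_mulOperator (m := fun x => 1 - σ x)
    (aestronglyMeasurable_const.sub hσ.aestronglyMeasurable) hmC
  have hcoer : ∀ f, c * ‖f‖ ^ 2 ≤ inner ℝ (S f) f := by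
    intro f
    rw [← real_inner_self_eq_norm_sq, inner_eq_integral_of_ae_eq (hS f) ae_eq_rfl, L2.inner_def,
      ← integral_const_mul]
    refine integral_mono_ae ((L2.integrable_inner f f).const_mul c) ?_ ?_
    · refine (L2.integrable_inner (S f) f).congr ?_
      filter_upwards [hS f] with x hx
      rw [hx]
    · filter_upwards [hb] with x hx
      rw [real_inner_smul_left]
      exact mul_le_mul_of_nonneg_right hx.1 real_inner_self_nonneg
  obtain ⟨A, hAm, hAeq, hAu⟩ := exists_solutionOperator hc hcoer
  -- Substituting `u = u_bg + w` turns the weak equation into one for `∇w` with right-hand side `(1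
  -- - σ) ∇u_bg`, which is `M Φ`; hence `∇w = A (M Φ)`.
  refine ⟨ρ, hρ.1, hρ.2, hσρ, M, A ∘L M, hM, fun θ η Φ hΦ => ?_⟩
  set k := dipoleField (boundaryPoint θ) (boundaryPoint η) with hk
  have hbg := isBackgroundPotential_dipole θ η
  rw [← hk] at hbg
  have hki : Integrable k diskMeasure := integrable_dipoleField _ _
  have hMΦ : M Φ =ᵐ[diskMeasure] fun x => (1 - σ x) • k x := by
    filter_upwards [hM Φ, hΦ, hσρ] with x h1 h2 h3
    rw [h1, h2]
    by_cases hx : x ∈ Metric.closedBall (0 : ℂ) ρ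
    · rw [Set.indicator_of_mem hx]
    · rw [h3 hx, sub_self, zero_smul, zero_smul]
  have hint : ∀ f : FieldSpace, Integrable f diskMeasure := fun f =>
    integrable_of_memLp_two (Lp.memLp f)
  have hσi : ∀ {G : ℂ → ℂ}, Integrable G diskMeasure → ∀ {φ : ℂ → ℝ}, ContDiff ℝ ∞ φ →
      Integrable (fun x => σ x * inner ℝ (G x) (∇ φ x)) diskMeasure := fun hG φ hφ =>
    (integrable_inner_of_continuous hG (continuous_gradient hφ)).bdd_mul hσ.aestronglyMeasurable
      (c := C) hσC
  -- the weak equation in terms of the difference to the background field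
  have hweak : ∀ f : FieldSpace, ∀ φ : ℂ → ℝ, ContDiff ℝ ∞ φ → ∀ g : FieldSpace,
      g =ᵐ[diskMeasure] ∇ φ → ∫ x in unitDisk, σ x * inner ℝ (k x + f x) (∇ φ x) =
        (∫ x in unitDisk, inner ℝ (k x) (∇ φ x)) + (inner ℝ (S f) g - inner ℝ (M Φ) g) := by
    intro f φ hφ g hg
    rw [inner_eq_integral_of_ae_eq (hS f) hg, inner_eq_integral_of_ae_eq hMΦ hg]
    simp only [inner_add_left, real_inner_smul_left, mul_add, sub_mul, one_mul]
    have h1 := integrable_inner_of_continuous hki (continuous_gradient hφ)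
    rw [integral_add (hσi hki hφ) (hσi (hint f) hφ), integral_sub h1 (hσi hki hφ)]
    ring
  constructor
  · obtain ⟨w, hw⟩ := exists_primitive (hAm (M Φ))
    refine ⟨dipolePotential (boundaryPoint θ) (boundaryPoint η) + w, k + A (M Φ), 
      ⟨⟨?_, ?_, ?_⟩, ?_⟩, _, _, hbg, ?_⟩
    · exact hbg.memSobolev.memLp.add (memLp_one_iff_integrable.2 (integrable_of_memLp_two hw.memLp))
    · exact hbg.memSobolev.memLp_grad.add (memLp_one_iff_integrable.2 (hint _))
    · exact hbg.memSobolev.hasWeakGradient.add hw.hasWeakGradient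
        (memLp_one_iff_integrable.1 hbg.memSobolev.memLp) (integrable_of_memLp_two hw.memLp) hki
        (hint _)
    · intro φ hφ
      have h1 := hweak (A (M Φ)) φ hφ _ (memLp_gradient hφ).coeFn_toLp
      rw [hAeq _ _ (toLp_gradient_mem hφ), sub_self, add_zero] at h1
      have h2 := hbg.weak_eq φ hφ
      simp only [one_mul] at h2
      rw [← h2, ← h1]
      rfl
    · rwa [add_sub_cancel_left, add_sub_cancel_left]
  · rintro u G ⟨hu, u₀, G₀, hu₀, hw⟩
    have h0 := hu₀.ae_eq hbg
    set D : FieldSpace := hw.memLp_grad.toLp (G - G₀) with hD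
    have hDG : D =ᵐ[diskMeasure] G - G₀ := hw.memLp_grad.coeFn_toLp
    have hDm : D ∈ gradientSpace :=
      mem_gradientSpace_of_isCurlFree ((hw.isCurlFree (by norm_num)).congr_ae hDG.symm)
    have hGD : G =ᵐ[diskMeasure] fun x => k x + D x := by
      filter_upwards [h0, hDG] with x h1 h2
      rw [h2, Pi.sub_apply, h1]; ring
    have hDA : D = A (M Φ) := by
      refine hAu _ _ hDm ?_
      rintro g ⟨φ, hφ, hg⟩
      have h1 := hweak D φ hφ g hg
      have h2 : ∫ x in unitDisk, σ x * inner ℝ (k x + D x) (∇ φ x) =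
          ∫ x in unitDisk, inner ℝ (k x) (∇ φ x) := by
        have h3 := hbg.weak_eq φ hφ
        simp only [one_mul] at h3
        rw [h3, ← hu.weak_eq φ hφ]
        refine integral_congr_ae ?_
        filter_upwards [hGD] with x hx
        rw [hx]
      rw [h2] at h1
      linarith
    rw [ContinuousLinearMap.comp_apply, ← hDA]
    exact hGD

/-! ### Trigonometric series and continuation to a strip -/

lemma norm_exp_mul_I_le (n : ℕ) {z : ℂ} {l : ℝ} (hz : |z.im| ≤ l) :
    ‖Complex.exp (((n + 1 : ℕ) * z) * Complex.I)‖ ≤ Real.exp l ^ (n + 1) ∧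
      ‖Complex.exp (-((n + 1 : ℕ) * z) * Complex.I)‖ ≤ Real.exp l ^ (n + 1) := by
  have h := abs_le.1 hz
  rw [Complex.norm_exp, Complex.norm_exp, ← Real.exp_nat_mul]
  constructor <;> refine Real.exp_le_exp.2 ?_ <;> simp
  · nlinarith [(Nat.cast_nonneg n : (0 : ℝ) ≤ n)]
  · nlinarith [(Nat.cast_nonneg n : (0 : ℝ) ≤ n)]

lemma norm_cos_nat_mul_le (n : ℕ) {z : ℂ} {l : ℝ} (hz : |z.im| ≤ l) :
    ‖Complex.cos ((n + 1 : ℕ) * z)‖ ≤ Real.exp l ^ (n + 1) := by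
  obtain ⟨h1, h2⟩ := norm_exp_mul_I_le n hz
  rw [Complex.cos, norm_div, Complex.norm_two]
  linarith [norm_add_le (Complex.exp (((n + 1 : ℕ) * z) * Complex.I))
    (Complex.exp (-((n + 1 : ℕ) * z) * Complex.I))]

lemma norm_sin_nat_mul_le (n : ℕ) {z : ℂ} {l : ℝ} (hz : |z.im| ≤ l) :
    ‖Complex.sin ((n + 1 : ℕ) * z)‖ ≤ Real.exp l ^ (n + 1) := by
  obtain ⟨h1, h2⟩ := norm_exp_mul_I_le n hz
  rw [Complex.sin, norm_div, Complex.norm_two, norm_mul, Complex.norm_I, mul_one]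
  linarith [norm_sub_le (Complex.exp (-((n + 1 : ℕ) * z) * Complex.I))
    (Complex.exp (((n + 1 : ℕ) * z) * Complex.I))]

/-- A bounded image of a trigonometric series with geometrically decaying coefficients extends
holomorphically to a strip. -/
lemma exists_analytic_extension {H E : Type*} [NormedAddCommGroup H] [NormedSpace ℝ H]
    [NormedAddCommGroup E] [NormedSpace ℂ E] [NormedSpace ℝ E] [IsScalarTower ℝ ℂ E]
    [CompleteSpace E] {f g : ℕ → H} {K ρ l : ℝ}
    (hρ : 0 < ρ) (hl : Real.exp l * ρ < 1) (hf : ∀ n, ‖f n‖ ≤ K * ρ ^ n)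
    (hg : ∀ n, ‖g n‖ ≤ K * ρ ^ n) {Φ : ℝ → H}
    (hΦ : ∀ t : ℝ, HasSum
      (fun n : ℕ => Real.cos ((n + 1 : ℕ) * t) • f n + Real.sin ((n + 1 : ℕ) * t) • g n) (Φ t))
    (ℓ : H →L[ℝ] E) :
    ∃ Ψ : ℂ → E, AnalyticOnNhd ℂ Ψ {z | |z.im| < l} ∧ ∀ t : ℝ, Ψ t = ℓ (Φ t) := by
  -- `H` is only a real space, so the complex coefficients are inserted after applying `ℓ`. On the
  -- strip they grow at most like `exp l ^ (n + 1)`, which the decay `ρ ^ n` absorbs.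
  refine ⟨fun z => ∑' n : ℕ, (Complex.cos ((n + 1 : ℕ) * z) • ℓ (f n) +
    Complex.sin ((n + 1 : ℕ) * z) • ℓ (g n)), ?_, fun t => ?_⟩
  · have hopen : IsOpen {z : ℂ | |z.im| < l} :=
      isOpen_lt (Complex.continuous_im.abs) continuous_const
    refine DifferentiableOn.analyticOnNhd ?_ hopen
    refine Complex.differentiableOn_tsum_of_summable_norm
      (u := fun n : ℕ => (2 * Real.exp l * ‖ℓ‖ * K) * (Real.exp l * ρ) ^ n)
      ((summable_geometric_of_lt_one (by positivity) hl).mul_left _) (fun n => ?_) hopen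
      fun n z hz => ?_
    · exact Differentiable.differentiableOn (by fun_prop)
    · have hz' : |z.im| ≤ l := le_of_lt hz
      have hb : ∀ h : H, ‖h‖ ≤ K * ρ ^ n → ‖ℓ h‖ ≤ ‖ℓ‖ * (K * ρ ^ n) := fun h hh =>
        (ℓ.le_opNorm h).trans (by gcongr)
      calc _ ≤ ‖Complex.cos ((n + 1 : ℕ) * z)‖ * ‖ℓ (f n)‖ +
            ‖Complex.sin ((n + 1 : ℕ) * z)‖ * ‖ℓ (g n)‖ := by
            rw [← norm_smul, ← norm_smul]; exact norm_add_le _ _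
        _ ≤ Real.exp l ^ (n + 1) * (‖ℓ‖ * (K * ρ ^ n)) +
            Real.exp l ^ (n + 1) * (‖ℓ‖ * (K * ρ ^ n)) := by
            gcongr
            · exact norm_cos_nat_mul_le n hz'
            · exact hb _ (hf n)
            · exact norm_sin_nat_mul_le n hz'
            · exact hb _ (hg n)
        _ = _ := by rw [mul_pow]; ring
  · have h := (hΦ t).mapL ℓ
    rw [← h.tsum_eq]
    refine tsum_congr fun n => ?_
    rw [map_add, map_smul, map_smul, ← algebraMap_smul ℂ (Real.cos _), ← algebraMap_smul ℂ (Real.sin _),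
      Complex.coe_algebraMap]
    push_cast
    rfl

lemma memLp_indicator_closedBall {ρ B : ℝ} {h : ℂ → ℂ} (hm : Measurable h)
    (hB : ∀ x ∈ Metric.closedBall (0 : ℂ) ρ, ‖h x‖ ≤ B) :
    MemLp ((Metric.closedBall (0 : ℂ) ρ).indicator h) 2 diskMeasure := by
  refine MemLp.of_bound (hm.indicator measurableSet_closedBall).aestronglyMeasurable (max B 0)
    (Filter.Eventually.of_forall fun x => ?_)
  by_cases hx : x ∈ Metric.closedBall (0 : ℂ) ρ
  · rw [Set.indicator_of_mem hx]; exact (hB x hx).trans (le_max_left _ _)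
  · rw [Set.indicator_of_notMem hx, norm_zero]; exact le_max_right _ _

lemma norm_toLp_indicator_le {ρ B : ℝ} {h : ℂ → ℂ} (h0 : 0 ≤ B)
    (hB : ∀ x ∈ Metric.closedBall (0 : ℂ) ρ, ‖h x‖ ≤ B)
    (hL : MemLp ((Metric.closedBall (0 : ℂ) ρ).indicator h) 2 diskMeasure) :
    ‖hL.toLp _‖ ≤ (measureUnivNNReal diskMeasure : ℝ) ^ (2 : ENNReal).toReal⁻¹ * B := by
  refine Lp.norm_le_of_ae_bound h0 ?_
  filter_upwards [hL.coeFn_toLp] with x hx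
  rw [hx]
  by_cases hx : x ∈ Metric.closedBall (0 : ℂ) ρ
  · rw [Set.indicator_of_mem hx]; exact hB x hx
  · rw [Set.indicator_of_notMem hx, norm_zero]; exact h0

/-- Away from the boundary, the field of a point source on the boundary depends on the position of
the source through a trigonometric series with geometrically decaying coefficients. -/
lemma exists_poleField_series {ρ : ℝ} (hρ0 : 0 < ρ) (hρ1 : ρ < 1) :
    ∃ (f g : ℕ → FieldSpace) (K : ℝ) (Φ : ℝ → FieldSpace), (∀ n, ‖f n‖ ≤ K * ρ ^ n) ∧
      (∀ n, ‖g n‖ ≤ K * ρ ^ n) ∧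
      (∀ t : ℝ, HasSum (fun n : ℕ => Real.cos ((n + 1 : ℕ) * t) • f n +
        Real.sin ((n + 1 : ℕ) * t) • g n) (Φ t)) ∧
      ∀ t : ℝ, Φ t =ᵐ[diskMeasure]
        (Metric.closedBall (0 : ℂ) ρ).indicator (poleField (boundaryPoint t)) := by
  set K : ℝ := (measureUnivNNReal diskMeasure : ℝ) ^ (2 : ENNReal).toReal⁻¹ with hK
  have hK0 : 0 ≤ K := by positivity
  have hxρ : ∀ x ∈ Metric.closedBall (0 : ℂ) ρ, ‖x‖ ≤ ρ := fun x hx => mem_closedBall_zero_iff.1 hx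
  have hfb : ∀ n : ℕ, ∀ x ∈ Metric.closedBall (0 : ℂ) ρ, ‖-(conj x ^ n)‖ ≤ ρ ^ n := fun n x hx => by
    rw [norm_neg, norm_pow, RCLike.norm_conj]
    gcongr; exact hxρ x hx
  have hgb : ∀ n : ℕ, ∀ x ∈ Metric.closedBall (0 : ℂ) ρ, ‖-(Complex.I * conj x ^ n)‖ ≤ ρ ^ n :=
    fun n x hx => by
      rw [norm_neg, norm_mul, Complex.norm_I, one_mul, norm_pow, RCLike.norm_conj]
      gcongr; exact hxρ x hx
  have hfL := fun n => memLp_indicator_closedBall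
    (h := fun x => -(conj x ^ n)) (by fun_prop) (hfb n)
  have hgL := fun n => memLp_indicator_closedBall
    (h := fun x => -(Complex.I * conj x ^ n)) (by fun_prop) (hgb n)
  -- the remainders of the geometric series
  set r : ℝ → ℕ → ℂ → ℂ := fun t n x =>
    poleField (boundaryPoint t) x * (conj x * boundaryPoint t) ^ n with hr
  have hrb : ∀ t n, ∀ x ∈ Metric.closedBall (0 : ℂ) ρ, ‖r t n x‖ ≤ (1 - ρ)⁻¹ * ρ ^ n := by
    intro t n x hx
    simp only [hr]
    rw [norm_mul, norm_pow, norm_mul, RCLike.norm_conj, norm_boundaryPoint, mul_one,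
      norm_poleField]
    have h1 : 1 - ρ ≤ ‖x - boundaryPoint t‖ := by
      have := norm_sub_norm_le (boundaryPoint t : ℂ) x
      rw [norm_boundaryPoint, norm_sub_rev] at this
      linarith [hxρ x hx]
    have h2 : 0 < 1 - ρ := by linarith
    gcongr
    exact hxρ x hx
  have hrm : ∀ t n, Measurable (r t n) := fun t n => by
    have := measurable_poleField (boundaryPoint t)
    fun_prop
  have hrL := fun t n => memLp_indicator_closedBall (hrm t n) (hrb t n)
  -- For `|b| = 1` one has `1 - conj x * b = -b * conj (x - b)`, which cancels the pole; the terms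
  -- of the series therefore telescope.
  have hstep : ∀ (t : ℝ) (n : ℕ), Real.cos ((n + 1 : ℕ) * t) • (hfL n).toLp _ +
      Real.sin ((n + 1 : ℕ) * t) • (hgL n).toLp _ =
        (hrL t n).toLp _ - (hrL t (n + 1)).toLp _ := by
    intro t n
    rw [← MemLp.toLp_const_smul, ← MemLp.toLp_const_smul, ← MemLp.toLp_add, ← MemLp.toLp_sub]
    refine MemLp.toLp_congr _ _ (Filter.Eventually.of_forall fun x => ?_)
    by_cases hx : x ∈ Metric.closedBall (0 : ℂ) ρ
    · simp only [Pi.add_apply, Pi.sub_apply, Pi.smul_apply, Set.indicator_of_mem hx]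
      have hb : (boundaryPoint t : ℂ) = Complex.exp (t * Complex.I) := rfl
      have hxb : conj (x - boundaryPoint t) ≠ 0 := by
        rw [map_ne_zero, sub_ne_zero]
        exact ne_of_mem_unitDisk (norm_boundaryPoint t)
          (Metric.closedBall_subset_ball hρ1 hx)
      have hbb : conj (boundaryPoint t : ℂ) * boundaryPoint t = 1 := by
        rw [← Complex.normSq_eq_conj_mul_self, Complex.normSq_eq_norm_sq, norm_boundaryPoint]
        simp
      have h1 : r t n x - r t (n + 1) x =
          -((boundaryPoint t : ℂ) ^ (n + 1) * conj x ^ n) := by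
        have h2 : poleField (boundaryPoint t) x * conj (x - boundaryPoint t) = 1 :=
          inv_mul_cancel₀ hxb
        have h3 : 1 - conj x * boundaryPoint t =
            -(boundaryPoint t * conj (x - boundaryPoint t)) := by
          rw [map_sub, mul_sub, mul_comm _ (conj (boundaryPoint t : ℂ)), hbb]; ring
        calc r t n x - r t (n + 1) x = poleField (boundaryPoint t) x *
              (1 - conj x * boundaryPoint t) * (conj x * boundaryPoint t) ^ n := by
              simp only [hr]; ring
          _ = -((poleField (boundaryPoint t) x * conj (x - boundaryPoint t)) *
              (boundaryPoint t ^ (n + 1) * conj x ^ n)) := by rw [h3]; ring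
          _ = _ := by rw [h2, one_mul]
      have h4 : (boundaryPoint t : ℂ) ^ (n + 1) =
          Real.cos ((n + 1 : ℕ) * t) + Real.sin ((n + 1 : ℕ) * t) * Complex.I := by
        rw [hb, ← Complex.exp_nat_mul, ← mul_assoc, Complex.exp_mul_I]
        push_cast
        rfl
      rw [h1, h4, Complex.real_smul, Complex.real_smul]
      ring
    · simp [Set.indicator_of_notMem hx]
  have hfn : ∀ n, ‖(hfL n).toLp _‖ ≤ K * ρ ^ n := fun n =>
    norm_toLp_indicator_le (by positivity) (hfb n) (hfL n)
  have hgn : ∀ n, ‖(hgL n).toLp _‖ ≤ K * ρ ^ n := fun n =>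
    norm_toLp_indicator_le (by positivity) (hgb n) (hgL n)
  refine ⟨fun n => (hfL n).toLp _, fun n => (hgL n).toLp _, K, fun t => (hrL t 0).toLp _, hfn, hgn,
    fun t => ?_, fun t => ?_⟩
  · have hgeo : Summable fun n : ℕ => 2 * K * ρ ^ n :=
      (summable_geometric_of_lt_one hρ0.le hρ1).mul_left _
    have hsum : Summable fun n : ℕ => Real.cos ((n + 1 : ℕ) * t) • (hfL n).toLp _ +
        Real.sin ((n + 1 : ℕ) * t) • (hgL n).toLp _ := by
      refine Summable.of_norm_bounded hgeo fun n => ?_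
      refine (norm_add_le _ _).trans ?_
      rw [norm_smul, norm_smul, Real.norm_eq_abs, Real.norm_eq_abs]
      have h1 := mul_le_mul (Real.abs_cos_le_one ((n + 1 : ℕ) * t)) (hfn n) (norm_nonneg _)
        zero_le_one
      have h2 := mul_le_mul (Real.abs_sin_le_one ((n + 1 : ℕ) * t)) (hgn n) (norm_nonneg _)
        zero_le_one
      linarith
    rw [hsum.hasSum_iff_tendsto_nat]
    simp only [hstep]
    simp only [Finset.sum_range_sub' (fun n => (hrL t n).toLp _)]
    have hlim : Filter.Tendsto (fun n => (hrL t n).toLp _) Filter.atTop (nhds 0) := by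
      have h1 : 0 < 1 - ρ := by linarith
      refine squeeze_zero_norm (fun n =>
        norm_toLp_indicator_le (by positivity) (hrb t n) (hrL t n)) ?_
      have := ((tendsto_pow_atTop_nhds_zero_of_lt_one hρ0.le hρ1).const_mul
        (1 - ρ)⁻¹).const_mul K
      rwa [mul_zero, mul_zero] at this
    simpa using hlim.const_sub ((hrL t 0).toLp _)
  · refine (hrL t 0).coeFn_toLp.trans (Filter.Eventually.of_forall fun x => ?_)
    simp [hr]

/-! ### The relative form as a bounded bilinear form, and its analyticity -/

/-- The relative form of two point current sources is a bounded bilinear form of the cut-offs of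
their background fields to a smaller concentric disk. -/
lemma exists_relativeOperator {σ : ℂ → ℝ} (hσ : IsFeasibleConductivity σ) :
    ∃ ρ : ℝ, 0 < ρ ∧ ρ < 1 ∧ ∃ R : FieldSpace →L[ℝ] FieldSpace, ∀ (θ : Fin 4 → ℝ)
      (Φ Φ' : FieldSpace),
      (Φ =ᵐ[diskMeasure] (Metric.closedBall (0 : ℂ) ρ).indicator
        (dipoleField (boundaryPoint (θ 0)) (boundaryPoint (θ 1)))) →
      (Φ' =ᵐ[diskMeasure] (Metric.closedBall (0 : ℂ) ρ).indicator
        (dipoleField (boundaryPoint (θ 2)) (boundaryPoint (θ 3)))) →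
      (∃ u G, IsPotential σ (dipole (θ 0) (θ 1)) u G) ∧
      ∀ u G v H, IsPotential σ (dipole (θ 0) (θ 1)) u G →
        IsBackgroundPotential (dipole (θ 2) (θ 3)) v H →
        IntegrableOn (fun x => (1 - σ x) * inner ℝ (G x) (H x)) unitDisk ∧
        ∫ x in unitDisk, (1 - σ x) * inner ℝ (G x) (H x) = inner ℝ (R Φ) Φ' := by
  obtain ⟨ρ, hρ0, hρ1, hσρ, M, T, hM, hT⟩ := exists_potentialOperator hσ
  -- On the smaller disk `∇u = Φ + T Φ`; outside it the factor `1 - σ` is zero, so cutting off both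
  -- fields does not change the integrand.
  refine ⟨ρ, hρ0, hρ1, M ∘L (ContinuousLinearMap.id ℝ FieldSpace + T), ?_⟩
  intro θ Φ Φ' hΦ hΦ'
  obtain ⟨hex, hG⟩ := hT (θ 0) (θ 1) Φ hΦ
  refine ⟨hex, fun u G v H hu hv => ?_⟩
  have hae : (fun x => inner ℝ (M (Φ + T Φ) x) (Φ' x)) =ᵐ[diskMeasure]
      fun x => (1 - σ x) * inner ℝ (G x) (H x) := by
    filter_upwards [hσρ, hM (Φ + T Φ), Lp.coeFn_add Φ (T Φ), hΦ, hΦ', hG u G hu,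
      hv.ae_eq (isBackgroundPotential_dipole (θ 2) (θ 3))] with x h1 h2 h3 h4 h5 h6 h7
    rw [h2, h3, Pi.add_apply, h4, h5, h6, h7, real_inner_smul_left]
    by_cases hx : x ∈ Metric.closedBall (0 : ℂ) ρ
    · rw [Set.indicator_of_mem hx, Set.indicator_of_mem hx]
    · rw [h1 hx, sub_self, zero_mul, zero_mul]
  refine ⟨(L2.integrable_inner (𝕜 := ℝ) (M (Φ + T Φ)) Φ').congr hae, ?_⟩
  rw [← integral_congr_ae hae]
  exact (L2.inner_def _ _).symm

/-- The bilinear form `⟪R f, g⟫` factors through the evaluation pairing of complex Banach spaces. -/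
lemma exists_bilinear_extension (R : FieldSpace →L[ℝ] FieldSpace) :
    ∃ (ℓ₁ : FieldSpace →L[ℝ] (FieldSpace →L[ℝ] ℂ))
      (ℓ₂ : FieldSpace →L[ℝ] ((FieldSpace →L[ℝ] ℂ) →L[ℂ] ℂ)),
      ∀ f g, ℓ₂ g (ℓ₁ f) = (inner ℝ (R f) g : ℝ) := by
  -- The real inner product is not complex bilinear. Sending one argument to a `ℂ`-valued functional
  -- and the other to evaluation makes it a complex bilinear pairing, so each factor can be
  -- continued separately.
  let ℓ₁ : FieldSpace →L[ℝ] (FieldSpace →L[ℝ] ℂ) :=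
    LinearMap.mkContinuous₂ (LinearMap.mk₂ ℝ
      (fun f g : FieldSpace => ((inner ℝ (R f) g : ℝ) : ℂ))
      (fun f f' g => by simp [inner_add_left]) (fun a f g => by simp [real_inner_smul_left])
      (fun f g g' => by simp [inner_add_right]) (fun a f g => by simp [real_inner_smul_right]))
      ‖R‖ (fun f g => by
        rw [LinearMap.mk₂_apply, Complex.norm_real]
        exact (norm_inner_le_norm (R f) g).trans
          (mul_le_mul_of_nonneg_right (R.le_opNorm f) (norm_nonneg g)))
  let ev : FieldSpace → ((FieldSpace →L[ℝ] ℂ) →L[ℂ] ℂ) := fun g =>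
    LinearMap.mkContinuous
      { toFun := fun L => L g, map_add' := fun _ _ => rfl, map_smul' := fun _ _ => rfl } ‖g‖
      (fun L => by rw [mul_comm]; exact L.le_opNorm g)
  let ℓ₂ : FieldSpace →L[ℝ] ((FieldSpace →L[ℝ] ℂ) →L[ℂ] ℂ) :=
    LinearMap.mkContinuous
      { toFun := ev
        map_add' := fun f g => by ext L; exact map_add L f g
        map_smul' := fun c g => by ext L; exact map_smul L c g } 1
      (fun g => by
        rw [one_mul]
        exact ContinuousLinearMap.opNorm_le_bound (ev g) (norm_nonneg g) (fun L => by
          rw [mul_comm]; exact L.le_opNorm g))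
  exact ⟨ℓ₁, ℓ₂, fun f g => rfl⟩

lemma cutoff_dipoleField_ae_eq {ρ : ℝ} {Φ : ℝ → FieldSpace} (hΦ : ∀ t : ℝ, Φ t =ᵐ[diskMeasure]
    (Metric.closedBall (0 : ℂ) ρ).indicator (poleField (boundaryPoint t))) (θ η : ℝ) :
    (Real.pi⁻¹ • (Φ η - Φ θ) : FieldSpace) =ᵐ[diskMeasure]
      (Metric.closedBall (0 : ℂ) ρ).indicator
        (dipoleField (boundaryPoint θ) (boundaryPoint η)) := by
  filter_upwards [Lp.coeFn_smul Real.pi⁻¹ (Φ η - Φ θ), Lp.coeFn_sub (Φ η) (Φ θ), hΦ η, hΦ θ]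
    with x h1 h2 h3 h4
  rw [h1, Pi.smul_apply, h2, Pi.sub_apply, h3, h4]
  by_cases hx : x ∈ Metric.closedBall (0 : ℂ) ρ
  · simp only [Set.indicator_of_mem hx, dipoleField]
  · simp only [Set.indicator_of_notMem hx, sub_self, smul_zero]

lemma exists_exp_mul_lt_one {ρ : ℝ} (h0 : 0 < ρ) (h1 : ρ < 1) :
    ∃ l : ℝ, 0 < l ∧ Real.exp l * ρ < 1 := by
  refine ⟨-Real.log ρ / 2, by linarith [Real.log_neg h0 h1], ?_⟩
  nth_rw 2 [← Real.exp_log h0]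
  rw [← Real.exp_add, Real.exp_lt_one_iff]
  linarith [Real.log_neg h0 h1]

/-- The first conjunct says that the function is well defined by the integral formula: the
potentials exist, and the formula does not depend on the choice of their representatives. -/
theorem mainTheorem8 (σ : ℂ → ℝ) (hσ : IsFeasibleConductivity σ) :
    (∀ θ : Fin 4 → ℝ,
      (∃ u G, IsPotential σ (dipole (θ 0) (θ 1)) u G) ∧
      (∃ v H, IsBackgroundPotential (dipole (θ 2) (θ 3)) v H) ∧
      ∀ u G v H, IsPotential σ (dipole (θ 0) (θ 1)) u G →
        IsBackgroundPotential (dipole (θ 2) (θ 3)) v H →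
        IntegrableOn (fun x => (1 - σ x) * inner ℝ (G x) (H x)) unitDisk ∧
        fourElectrode σ θ = ∫ x in unitDisk, (1 - σ x) * inner ℝ (G x) (H x)) ∧
    AnalyticOnNhd ℝ (fourElectrode σ) Set.univ ∧
    ∃ l : ℝ, 0 < l ∧ ∃ F : (Fin 4 → ℂ) → ℂ,
      AnalyticOnNhd ℂ F (productStrip l) ∧
      ∀ θ : Fin 4 → ℝ, F (fun i => (θ i : ℂ)) = (fourElectrode σ θ : ℂ) := by
  obtain ⟨ρ, hρ0, hρ1, R, hR⟩ := exists_relativeOperator hσ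
  obtain ⟨f, g, K, Φ, hf, hg, hsum, hΦ⟩ := exists_poleField_series hρ0 hρ1
  have hD := cutoff_dipoleField_ae_eq hΦ
  have hbg : ∀ θ η : ℝ, ∃ v H, IsBackgroundPotential (dipole θ η) v H := fun θ η =>
    ⟨_, _, isBackgroundPotential_dipole θ η⟩
  have hval : ∀ θ : Fin 4 → ℝ, fourElectrode σ θ =
      inner ℝ (R (Real.pi⁻¹ • (Φ (θ 1) - Φ (θ 0)))) (Real.pi⁻¹ • (Φ (θ 3) - Φ (θ 2))) := by
    intro θ
    obtain ⟨⟨u, G, hu⟩, h⟩ := hR θ _ _ (hD (θ 0) (θ 1)) (hD (θ 2) (θ 3))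
    obtain ⟨v, H, hv⟩ := hbg (θ 2) (θ 3)
    -- Existence makes the chosen gradients genuine solutions, to which the representation valid for
    -- every choice applies.
    obtain ⟨u', hu'⟩ : ∃ u, IsPotential σ (dipole (θ 0) (θ 1)) u
        (gradPotential σ (dipole (θ 0) (θ 1))) :=
      Classical.epsilon_spec (p := fun G => ∃ u, IsPotential σ (dipole (θ 0) (θ 1)) u G) ⟨G, u, hu⟩
    obtain ⟨v', hv'⟩ : ∃ v, IsBackgroundPotential (dipole (θ 2) (θ 3)) v
        (gradBackground (dipole (θ 2) (θ 3))) :=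
      Classical.epsilon_spec (p := fun H => ∃ v, IsBackgroundPotential (dipole (θ 2) (θ 3)) v H)
        ⟨H, v, hv⟩
    exact (h _ _ _ _ hu' hv').2
  obtain ⟨l, hl0, hl⟩ := exists_exp_mul_lt_one hρ0 hρ1
  obtain ⟨ℓ₁, ℓ₂, hℓ⟩ := exists_bilinear_extension R
  obtain ⟨Ψ₁, hΨ₁, hΨ₁Φ⟩ := exists_analytic_extension hρ0 hl hf hg hsum ℓ₁
  obtain ⟨Ψ₂, hΨ₂, hΨ₂Φ⟩ :=
    exists_analytic_extension (E := (FieldSpace →L[ℝ] ℂ) →L[ℂ] ℂ) hρ0 hl hf hg hsum ℓ₂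
  set F : (Fin 4 → ℂ) → ℂ := fun z =>
    (Real.pi⁻¹ * Real.pi⁻¹ : ℂ) * (Ψ₂ (z 3) - Ψ₂ (z 2)) (Ψ₁ (z 1) - Ψ₁ (z 0)) with hF
  have hFa : AnalyticOnNhd ℂ F (productStrip l) := by
    intro z hz
    have hproj : ∀ i : Fin 4, AnalyticAt ℂ (fun z : Fin 4 → ℂ => z i) z := fun i =>
      (ContinuousLinearMap.proj (R := ℂ) (φ := fun _ : Fin 4 => ℂ) i).analyticAt z
    have h1 : ∀ i : Fin 4, AnalyticAt ℂ (fun z : Fin 4 → ℂ => Ψ₁ (z i)) z := fun i =>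
      AnalyticAt.fun_comp (hΨ₁ (z i) (hz i)) (hproj i)
    have h2 : ∀ i : Fin 4, AnalyticAt ℂ (fun z : Fin 4 → ℂ => Ψ₂ (z i)) z := fun i =>
      AnalyticAt.fun_comp (hΨ₂ (z i) (hz i)) (hproj i)
    have h3 := ((ContinuousLinearMap.id ℂ ((FieldSpace →L[ℝ] ℂ) →L[ℂ] ℂ)).analyticAt_bilinear
      (Ψ₂ (z 3) - Ψ₂ (z 2), Ψ₁ (z 1) - Ψ₁ (z 0))).fun_comp (f := fun z : Fin 4 → ℂ =>
        (Ψ₂ (z 3) - Ψ₂ (z 2), Ψ₁ (z 1) - Ψ₁ (z 0)))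
      (((h2 3).sub (h2 2)).prod ((h1 1).sub (h1 0)))
    exact analyticAt_const.mul h3
  have hFθ : ∀ θ : Fin 4 → ℝ, F (fun i => (θ i : ℂ)) = (fourElectrode σ θ : ℂ) := by
    intro θ
    simp only [hF]
    rw [hval, hΨ₁Φ, hΨ₁Φ, hΨ₂Φ, hΨ₂Φ, ← map_sub, sub_apply, hℓ, hℓ, map_smul,
      real_inner_smul_left, real_inner_smul_right, inner_sub_right]
    push_cast
    ring
  refine ⟨fun θ => ?_, ?_, l, hl0, F, hFa, hFθ⟩
  · obtain ⟨hex, h⟩ := hR θ _ _ (hD (θ 0) (θ 1)) (hD (θ 2) (θ 3))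
    refine ⟨hex, hbg _ _, fun u G v H hu hv => ?_⟩
    obtain ⟨h1, h2⟩ := h u G v H hu hv
    exact ⟨h1, by rw [hval, h2]⟩
  -- Real analyticity follows by restricting `F` to real arguments and taking the real part; `0 < l`
  -- puts the real points inside the strip.
  · intro θ _
    have hcast : AnalyticAt ℝ (fun θ : Fin 4 → ℝ => fun i => (θ i : ℂ)) θ :=
      (ContinuousLinearMap.pi fun i => Complex.ofRealCLM ∘L
        ContinuousLinearMap.proj (R := ℝ) (φ := fun _ : Fin 4 => ℝ) i).analyticAt θ
    have h1 : AnalyticAt ℝ F (fun i => (θ i : ℂ)) :=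
      (hFa _ (fun i => by simpa using hl0)).restrictScalars
    have h2 := (Complex.reCLM.analyticAt _).fun_comp (h1.fun_comp hcast)
    refine h2.congr (Filter.Eventually.of_forall fun θ => ?_)
    change (F fun i => (θ i : ℂ)).re = _
    rw [hFθ, Complex.ofReal_re]
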